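/- Let $\mathbb T$ be the unit circle with normalized Lebesgue measure $\ell$ ($d\ell=d\theta/2\pi$); all $L^p$ norms and all integrals $\int_J\cdot$ below are taken with respect to $\ell$. Let $\mathbb D$ be the open unit disk, let $I\subset\mathbb T$ be measurable with complement $J=\mathbb T\setminus I$, and suppose that $\ell(I)>0$, $\ell(J)>0$ and $\ell(\partial I)=0$. For functions $h_1$ on $I$ and $h_2$ on $J$, write $h_1\vee h_2$ for the function on $\mathbb T$ equal to $h_1$ on $I$ and to $h_2$ on $J$. The Hardy space $H^2$ is the set of functions in $L^2(\mathbb T)$ whose Fourier coefficients of strictly negative index vanish; its members are identified with holomorphic functions in $\mathbb D$ through the Cauchy integral $g(z)=\frac1{2i\pi}\int_{\mathbb T}\frac{g(\xi)}{\xi-z}\,d\xi$. The anti-analytic projection on $L^2(\mathbb T)$ is $\mathbf P_-\bigl(\sum_{n\in\mathbb Z}a_ne^{in\theta}\bigr)=\sum_{n<0}a_ne^{in\theta}$. Let $M\in L^2(J)$ be non-negative with $\log M\in L^1(J)$, and let $f\in L^2(I)$ be such that there is no $g\in H^2$ with $g=f$ a.e. on $I$ and $|g|\le M$ a.e. on $J$.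 Let $\mu\ge0$ be a function on $J$ with $\mu M^2\in L^1(J)$ and $\log\mu\in L^1(J)$ (so $M>0$ and $\mu>0$ a.e. on $J$, as $\log 0=-\infty$). Let $$w_{\mu^{1/2}}(z)=\exp\Bigl\{\frac1{2\pi}\int_{0}^{2\pi}\frac{e^{i\theta}+z}{e^{i\theta}-z}\,\log\bigl(1\vee\mu^{1/2}\bigr)(e^{i\theta})\,d\theta\Bigr\},\qquad z\in\mathbb D,$$ be the outer function with modulus $1$ a.e. on $I$ and $\mu^{1/2}$ a.e. on $J$; on $\mathbb T$ it is understood through its nontangential boundary values. Define $$\Phi_M(\mu)=\inf_{g\in H^2}\ \Bigl(\|f-g\|^2_{L^2(I)}+\int_J\mu\,(|g|^2-M^2)\,d\ell\Bigr),$$ where the integral over $J$ is $+\infty$ if $\mu|g|^2\notin L^1(J)$. Then: 1. $fw_{\mu^{1/2}}\vee0\in L^2(\mathbb T)$ and $$\Phi_M(\mu)=\bigl\|\mathbf P_-\bigl(fw_{\mu^{1/2}}\vee0\bigr)\bigr\|^2_{L^2(\mathbb T)}-\bigl\|\mu^{1/2}M\bigr\|^2_{L^2(J)}.$$ 2. Put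 $$g_\mu(z)=\frac1{2i\pi\,w_{\mu^{1/2}}(z)}\int_I\frac{w_{\mu^{1/2}}(\xi)f(\xi)}{\xi-z}\,d\xi,\qquad z\in\mathbb D.$$ If $g_\mu\in H^2$, then the infimum defining $\Phi_M(\mu)$ is attained at $g=g_\mu$. 3. If $1/\mu\in L^\infty(J)$, then $g_\mu\in H^2$; hence, by 2, the infimum is attained at $g_\mu$. -/

import Mathlib

open MeasureTheory

namespace HardyDual

instance factTwoPiPos : Fact (0 < 2 * Real.pi) := ⟨Real.two_pi_pos⟩

/-- The unit circle, parametrized by the angle `θ` modulo `2π`. -/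
abbrev Torus : Type := AddCircle (2 * Real.pi)

/-- The point `e^{iθ}` of the complex plane. -/
noncomputable def pt (θ : Torus) : ℂ := (AddCircle.toCircle θ : ℂ)

/-- The normalized Lebesgue measure of the circle, `dθ / 2π`. -/
noncomputable abbrev ell : Measure Torus := AddCircle.haarAddCircle

/-- The Hilbert space `L²(𝕋)`. -/
abbrev L2T : Type := Lp ℂ 2 ell

/-- The Hardy space `H²`: functions in `L²(𝕋)` whose Fourier coefficients of strictly negative
index vanish. -/
def H2 : Set L2T := {g | ∀ n : ℤ, n < 0 → fourierCoeff (g : Torus → ℂ) n = 0}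

/-- The anti-analytic projection on `L²(𝕋)`:
`∑ aₙ e^{inθ} ↦ ∑_{n < 0} aₙ e^{inθ}` (the series converges in `L²(𝕋)`). -/
noncomputable def Pminus (u : L2T) : L2T :=
  ∑' n : ℤ, if n < 0 then fourierCoeff (u : Torus → ℂ) n • fourierLp 2 n else 0

open Classical in
/-- The concatenation `h₁ ∨ h₂`, equal to `h₁` on `S` and to `h₂` on the complement of `S`. -/
noncomputable def concat {α : Type*} (S : Set Torus) (h₁ h₂ : Torus → α) (t : Torus) : α :=
  if t ∈ S then h₁ t else h₂ t

/-- The line integral `∫_S F(ξ) dξ` over a subset `S` of the circle; with `ξ = e^{iθ}` one has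
`dξ = i e^{iθ} dθ = 2πi ξ (dθ / 2π)`. -/
noncomputable def lineIntegral (S : Set Torus) (F : Torus → ℂ) : ℂ :=
  ∫ t in S, F t * (2 * Real.pi * Complex.I * pt t) ∂ell

/-- The Cauchy integral `(1 / 2πi) ∫_𝕋 h(ξ) / (ξ - z) dξ`, which for `h ∈ H²` is the holomorphic
function in the disk with boundary values `h`. -/
noncomputable def cauchyExt (h : Torus → ℂ) (z : ℂ) : ℂ :=
  1 / (2 * Complex.I * Real.pi) * lineIntegral Set.univ (fun t => h t / (pt t - z))

/-- The function `F` on the disk is the member of `H²` with boundary values `g`. -/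
def IsH2With (F : ℂ → ℂ) (g : L2T) : Prop :=
  g ∈ H2 ∧ ∀ z ∈ Metric.ball (0 : ℂ) 1, F z = cauchyExt (g : Torus → ℂ) z

/-- The outer function in the disk with boundary modulus `ρ`. -/
noncomputable def outer (ρ : Torus → ℝ) (z : ℂ) : ℂ :=
  Complex.exp (∫ t, (pt t + z) / (pt t - z) * (Real.log (ρ t) : ℂ) ∂ell)

/-- The nontangential approach region (Stolz region) of aperture `α` at `e^{iθ}`. -/
def stolz (α : ℝ) (t : Torus) : Set ℂ :=
  {z | ‖z‖ < 1 ∧ ‖z - pt t‖ < α * (1 - ‖z‖)}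

/-- Nontangential approach to `e^{iθ}` from inside the disk: a function tends to `c` along this
filter iff it does so in each region `stolz α`, `α > 1`. -/
noncomputable def ntFilter (t : Torus) : Filter ℂ :=
  ⨆ α : {α : ℝ // 1 < α}, nhdsWithin (pt t) (stolz α t)

/-- The nontangential boundary values of a function on the disk. -/
noncomputable def bdry (F : ℂ → ℂ) (t : Torus) : ℂ := Filter.limUnder (ntFilter t) F

/-- `w_{μ^{1/2}}`: the outer function with modulus `1` on `S` and `μ^{1/2}` off `S`. -/
noncomputable def wSqrt (S : Set Torus) (μ : Torus → ℝ) : ℂ → ℂ :=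
  outer (concat S (fun _ => 1) (fun t => Real.sqrt (μ t)))

/-- The extended integral `∫ h⁺ - ∫ h⁻` of a real function. -/
noncomputable def eintegral (ν : Measure Torus) (h : Torus → ℝ) : EReal :=
  ((∫⁻ t, ENNReal.ofReal (h t) ∂ν : ENNReal) : EReal) -
    ((∫⁻ t, ENNReal.ofReal (-h t) ∂ν : ENNReal) : EReal)

/-- The class `L¹₊(M²dθ, J)`, `J` the complement of `S`: non-negative functions `μ` with
`μ M² ∈ L¹(J)` and `log μ ∈ L¹(J)`. As `log 0 = -∞`, the last condition forces `μ > 0` a.e. -/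
structure MemL1Plus (S : Set Torus) (M μ : Torus → ℝ) : Prop where
  pos : ∀ᵐ t ∂ell.restrict Sᶜ, 0 < μ t
  integrable : Integrable (fun t => μ t * M t ^ 2) (ell.restrict Sᶜ)
  integrable_log : Integrable (fun t => Real.log (μ t)) (ell.restrict Sᶜ)

/-- The criterion `‖f - g‖²_{L²(S)} + ∫_{𝕋∖S} μ (|g|² - M²)`, possibly `+∞`. -/
noncomputable def criterion (S : Set Torus) (f : Torus → ℂ) (M μ : Torus → ℝ) (g : L2T) : EReal :=
  ((eLpNorm (fun t => f t - g t) 2 (ell.restrict S) ^ 2 : ENNReal) : EReal) +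
    eintegral (ell.restrict Sᶜ) (fun t => μ t * (‖g t‖ ^ 2 - M t ^ 2))

/-- The dual functional `Φ_M(μ)`. -/
noncomputable def dualFunctional (S : Set Torus) (f : Torus → ℂ) (M μ : Torus → ℝ) : EReal :=
  ⨅ g ∈ H2, criterion S f M μ g

/-- The Carleman-type function
`g_μ(z) = (1 / (2iπ w_{μ^{1/2}}(z))) ∫_S w_{μ^{1/2}}(ξ) f(ξ) / (ξ - z) dξ`. -/
noncomputable def carleman (S : Set Torus) (f : Torus → ℂ) (μ : Torus → ℝ) (z : ℂ) : ℂ :=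
  1 / (2 * Complex.I * Real.pi * wSqrt S μ z) *
    lineIntegral S (fun t => bdry (wSqrt S μ) t * f t / (pt t - z))

end HardyDual

namespace HardyDual

open scoped ComplexConjugate Topology
open Filter

/-! Write `w` for the boundary function of the outer function, `u = fw ∨ 0`, and `P₊ = 1 - P₋`.
Since `|w| = 1` on `S` and `|w|² = μ` off `S`, the criterion at `g` equals `‖u - gw‖² - ∫ μM²` over
the complement whenever `gw ∈ L²`, and it is `+∞` otherwise (`criterion_eq`, `criterion_eq_top`).
The weighted problem is thus an unweighted distance problem for `gw`.

If `g ∈ H²` and `gw ∈ L²`, then `gw ∈ H²` (`IsHardy.mul_outer`), and Pythagoras gives `‖u - gw‖² =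
‖P₋u‖² + ‖P₊u - gw‖²`. The products `gw` are dense in `H²` because `w` is outer
(`exists_tendsto_mul_outer`), so the infimum of the last term is `0`, which is the formula for the
dual functional. The infimum is attained when `gw = P₊u`. In the disk this says that `g` is the
Cauchy integral of `u` divided by the outer function, that is, the Carleman-type function
(`ae_mul_outer_eq`). When `1/μ` is bounded, so is `1/w`, and this quotient lies in `H²`.

The outer function may be unbounded with unbounded inverse, so it is treated as a quotient `l / k`
of bounded outer functions (`exists_boundary_quotient`). Boundary values come from Fatou's theorem
for Poisson integrals. Both facts about `gw` rest on `exists_approx_inverse`: a bounded outer `k`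
admits bounded analytic `q j` with `|k q j| ≤ 1` and `k q j → 1` a.e. -/

/-! ### The circle and the power series of the Cauchy integral -/

theorem norm_pt (t : Torus) : ‖pt t‖ = 1 := Circle.norm_coe _

theorem pt_ne_zero (t : Torus) : pt t ≠ 0 := by
  rw [← norm_ne_zero_iff, norm_pt]; exact one_ne_zero

theorem continuous_pt : Continuous pt :=
  continuous_induced_dom.comp AddCircle.continuous_toCircle

theorem pt_mul_conj (t : Torus) : pt t * conj (pt t) = 1 := by
  rw [Complex.mul_conj, Complex.normSq_eq_norm_sq, norm_pt]; simp

theorem fourier_natCast (n : ℕ) (t : Torus) : fourier (n : ℤ) t = pt t ^ n := by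
  rw [fourier_apply, natCast_zsmul, AddCircle.toCircle_nsmul, Circle.coe_pow]; rfl

theorem fourier_neg_natCast (n : ℕ) (t : Torus) : fourier (-(n : ℤ)) t = conj (pt t) ^ n := by
  rw [fourier_neg, fourier_natCast, map_pow]

theorem norm_fourier_apply (n : ℤ) (t : Torus) : ‖fourier n t‖ = 1 := by
  rw [fourier_apply]; exact Circle.norm_coe _

theorem pt_sub_ne_zero {z : ℂ} (hz : ‖z‖ < 1) (t : Torus) : pt t - z ≠ 0 := by
  intro h
  rw [sub_eq_zero] at h
  rw [← h, norm_pt] at hz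
  exact lt_irrefl _ hz

theorem one_sub_norm_le {z : ℂ} (t : Torus) : 1 - ‖z‖ ≤ ‖pt t - z‖ := by
  have := norm_sub_norm_le (pt t) z
  rwa [norm_pt] at this

theorem lineIntegral_div (S : Set Torus) (F : Torus → ℂ) (z : ℂ) :
    1 / (2 * Complex.I * Real.pi) * lineIntegral S (fun t => F t / (pt t - z)) =
      ∫ t in S, F t * (pt t / (pt t - z)) ∂ell := by
  unfold lineIntegral
  rw [← integral_const_mul]
  congr 1
  ext t
  have hI : (Complex.I : ℂ) ≠ 0 := Complex.I_ne_zero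
  have hpi : (Real.pi : ℂ) ≠ 0 := by exact_mod_cast Real.pi_ne_zero
  field_simp

theorem cauchyExt_eq (a : Torus → ℂ) (z : ℂ) :
    cauchyExt a z = ∫ t, a t * (pt t / (pt t - z)) ∂ell := by
  unfold cauchyExt
  rw [lineIntegral_div, Measure.restrict_univ]

theorem norm_mul_conj_pt (z : ℂ) (t : Torus) : ‖z * conj (pt t)‖ = ‖z‖ := by
  rw [norm_mul, RCLike.norm_conj, norm_pt, mul_one]

theorem hasSum_pt_div {z : ℂ} (hz : ‖z‖ < 1) (t : Torus) :
    HasSum (fun n : ℕ => (z * conj (pt t)) ^ n) (pt t / (pt t - z)) := by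
  have h := hasSum_geometric_of_norm_lt_one (ξ := z * conj (pt t))
    (by rwa [norm_mul_conj_pt])
  have h2 : 1 - z * conj (pt t) = (pt t - z) * conj (pt t) := by
    rw [sub_mul, pt_mul_conj]
  have h3 : (pt t / (pt t - z)) = (1 - z * conj (pt t))⁻¹ := by
    have h4 : (conj (pt t))⁻¹ = pt t := (eq_inv_of_mul_eq_one_left (pt_mul_conj t)).symm
    rw [h2, mul_inv, h4, div_eq_mul_inv, mul_comm]
  rw [h3]
  exact h

/-- Termwise integration of the geometric series of the Cauchy kernel. Only the coefficients of
index `≥ 0` enter, so the Cauchy integral does not see the anti-analytic part of `a`. -/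
theorem hasSum_cauchyExt {a : Torus → ℂ} (ha : Integrable a ell) {z : ℂ} (hz : ‖z‖ < 1) :
    HasSum (fun n : ℕ => fourierCoeff a n * z ^ n) (cauchyExt a z) := by
  have hc : Continuous fun t : Torus => conj (pt t) := Complex.continuous_conj.comp continuous_pt
  have key := hasSum_integral_of_summable_integral_norm (μ := ell)
    (F := fun (n : ℕ) t => a t * (z * conj (pt t)) ^ n) (fun n =>
      ha.mul_bdd (c := ‖z‖ ^ n) 
      (Continuous.aestronglyMeasurable (by fun_prop)) (Eventually.of_forall fun t => by
        rw [norm_pow, norm_mul_conj_pt])) (by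
      simp_rw [norm_mul, norm_pow, norm_mul_conj_pt, integral_mul_const]
      exact (summable_geometric_of_lt_one (norm_nonneg z) hz).mul_left _)
  rw [cauchyExt_eq]
  have e1 : (fun n : ℕ => fourierCoeff a n * z ^ n) =
      fun n => ∫ t, a t * (z * conj (pt t)) ^ n ∂ell := by
    ext n
    rw [fourierCoeff, ← integral_mul_const]
    congr 1
    ext t
    rw [fourier_neg_natCast, smul_eq_mul, mul_pow]
    ring
  have e2 : ∀ t, ∑' n : ℕ, a t * (z * conj (pt t)) ^ n = a t * (pt t / (pt t - z)) := fun t => by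
    rw [tsum_mul_left, (hasSum_pt_div hz t).tsum_eq]
  rw [e1]
  simpa only [e2] using key

/-- The Fourier coefficients of an absolutely convergent analytic trigonometric series. -/
theorem fourierCoeff_tsum {a : ℕ → ℂ} (ha : Summable fun n => ‖a n‖) (m : ℤ) :
    fourierCoeff (fun t : Torus => ∑' n, a n * pt t ^ n) m =
      if 0 ≤ m then a m.toNat else 0 := by
  have hc := continuous_pt
  have key := hasSum_integral_of_summable_integral_norm (μ := ell)
    (F := fun (n : ℕ) (t : Torus) => fourier (-m) t • (a n * pt t ^ n)) (fun n =>
      (Continuous.integrable_of_hasCompactSupport (by fun_prop)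
        (HasCompactSupport.of_compactSpace _))) (by
      simp_rw [norm_smul, norm_mul, norm_pow, norm_fourier_apply, norm_pt]
      simpa using ha)
  have e : ∀ n : ℕ, ∫ t : Torus, fourier (-m) t • (a n * pt t ^ n) ∂ell =
      if m = n then a n else 0 := by
    intro n
    have h1 := orthonormal_iff_ite.mp (orthonormal_fourier (T := 2 * Real.pi)) m n
    rw [ContinuousMap.inner_toLp] at h1
    simp only [smul_eq_mul]
    have : ∀ t : Torus, fourier (-m) t * (a n * pt t ^ n) =
        a n * (fourier (n : ℤ) t * conj (fourier m t)) := by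
      intro t
      rw [fourier_neg, fourier_natCast]; ring
    simp_rw [this]
    rw [integral_const_mul, h1]
    simp
  have e2 : ∀ t : Torus, ∑' n, fourier (-m) t • (a n * pt t ^ n) =
      fourier (-m) t • ∑' n, a n * pt t ^ n := fun t => by
    rw [tsum_const_smul'']
  simp_rw [e, e2] at key
  rw [fourierCoeff, ← key.tsum_eq]
  split_ifs with h
  · rw [tsum_eq_single m.toNat]
    · simp [Int.toNat_of_nonneg h]
    · intro n hn
      rw [if_neg]
      rintro rfl
      simp at hn
  · convert tsum_zero with n
    rw [if_neg]
    rintro rfl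
    simp at h

/-- Uniqueness of power series, read off the Fourier coefficients of the restriction to the circle
of radius `1/2`, where the series converges absolutely. -/
theorem fourierCoeff_eq_zero_of_hasSum {c : ℕ → ℂ}
    (h : ∀ z : ℂ, ‖z‖ < 1 → HasSum (fun n => c n * z ^ n) 0) (n : ℕ) : c n = 0 := by
  have h1 : ∀ t, HasSum (fun n => c n * (1 / 2) ^ n * pt t ^ n) 0 := fun t => by
    have := h ((1 / 2) * pt t) (by rw [norm_mul, norm_pt]; norm_num)
    simpa only [mul_pow, mul_assoc] using this
  have h2 : Summable fun n => ‖c n * (1 / 2) ^ n‖ := by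
    have := (h1 0).summable.norm
    simpa only [norm_mul, norm_pow, norm_pt, one_pow, mul_one] using this
  have h3 := fourierCoeff_tsum h2 n
  simp_rw [fun t => (h1 t).tsum_eq] at h3
  simpa [fourierCoeff] using h3.symm

/-! ### The Poisson kernel -/

/-- The Poisson kernel of the disk. -/
noncomputable def poissonKernel (z : ℂ) (t : Torus) : ℝ := (1 - ‖z‖ ^ 2) / ‖pt t - z‖ ^ 2

theorem poissonKernel_nonneg {z : ℂ} (hz : ‖z‖ < 1) (t : Torus) : 0 ≤ poissonKernel z t := by
  have : ‖z‖ ^ 2 ≤ 1 := pow_le_one₀ (norm_nonneg z) hz.le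
  exact div_nonneg (by linarith) (by positivity)

theorem continuous_pt_div {z : ℂ} (hz : ‖z‖ < 1) :
    Continuous fun t => pt t / (pt t - z) :=
  continuous_pt.div (continuous_pt.sub continuous_const) (pt_sub_ne_zero hz)

theorem continuous_poissonKernel {z : ℂ} (hz : ‖z‖ < 1) : Continuous (poissonKernel z) :=
  continuous_const.div ((continuous_pt.sub continuous_const).norm.pow 2) fun t => by
    have := pt_sub_ne_zero hz t
    positivity

theorem poissonKernel_eq {z : ℂ} (hz : ‖z‖ < 1) (t : Torus) :
    (poissonKernel z t : ℂ) = pt t / (pt t - z) + conj (pt t / (pt t - z)) - 1 := by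
  have h1 := pt_sub_ne_zero hz t
  have h2 : conj (pt t) - conj z ≠ 0 := by rw [← map_sub]; exact (map_ne_zero _).mpr h1
  have h3 : ((‖pt t - z‖ : ℂ)) ^ 2 = (pt t - z) * (conj (pt t) - conj z) := by
    rw [← map_sub, Complex.mul_conj, Complex.normSq_eq_norm_sq]; simp
  have h4 : (‖z‖ : ℂ) ^ 2 = z * conj z := by
    rw [Complex.mul_conj, Complex.normSq_eq_norm_sq]; simp
  unfold poissonKernel
  push_cast
  rw [h3, h4, map_div₀, map_sub]
  field_simp
  linear_combination (-1 : ℂ) * pt_mul_conj t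

theorem poissonKernel_eq_re {z : ℂ} (hz : ‖z‖ < 1) (t : Torus) :
    ((pt t + z) / (pt t - z)).re = poissonKernel z t := by
  have h : (pt t + z) / (pt t - z) = 2 * (pt t / (pt t - z)) - 1 := by
    have h1 := pt_sub_ne_zero hz t
    field_simp
    ring
  have h2 := congrArg Complex.re (poissonKernel_eq hz t)
  rw [h]
  simp only [Complex.ofReal_re, Complex.sub_re, Complex.add_re, Complex.conj_re,
    Complex.one_re] at h2
  rw [two_mul, Complex.sub_re, Complex.one_re, Complex.add_re, h2]

/-- The Poisson integral. -/
noncomputable def poissonInt (a : Torus → ℂ) (z : ℂ) : ℂ := ∫ t, poissonKernel z t * a t ∂ell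

theorem integrable_poissonKernel_mul {a : Torus → ℂ} (ha : Integrable a ell) {z : ℂ}
    (hz : ‖z‖ < 1) : Integrable (fun t => (poissonKernel z t : ℂ) * a t) ell := by
  have hc : Continuous fun t => (poissonKernel z t : ℂ) :=
    Complex.continuous_ofReal.comp (continuous_poissonKernel hz)
  obtain ⟨C, hC⟩ := isCompact_univ.exists_bound_of_continuousOn hc.continuousOn
  exact ha.bdd_mul hc.aestronglyMeasurable (Eventually.of_forall fun t => hC t trivial)

theorem fourierCoeff_conj (a : Torus → ℂ) (n : ℤ) :
    fourierCoeff (fun t => conj (a t)) n = conj (fourierCoeff a (-n)) := by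
  simp only [fourierCoeff]
  rw [← integral_conj]
  congr 1
  ext t
  simp only [smul_eq_mul, map_mul]
  rw [← fourier_neg, neg_neg]

/-- The Poisson integral of an analytic function of the circle is its Cauchy integral. -/
theorem poissonInt_eq_cauchyExt {a : Torus → ℂ} (ha : Integrable a ell)
    (hneg : ∀ n : ℤ, n < 0 → fourierCoeff a n = 0) {z : ℂ} (hz : ‖z‖ < 1) :
    poissonInt a z = cauchyExt a z := by
  have hc := continuous_pt_div hz
  have hc' : Continuous fun t => conj (pt t / (pt t - z)) := Complex.continuous_conj.comp hc
  have ha' : Integrable (fun t => conj (a t)) ell := by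
    simpa using Complex.conjCLE.toContinuousLinearMap.integrable_comp ha
  obtain ⟨C, hC⟩ := isCompact_univ.exists_bound_of_continuousOn hc.continuousOn
  have i1 : Integrable (fun t => a t * (pt t / (pt t - z))) ell :=
    ha.mul_bdd hc.aestronglyMeasurable (Eventually.of_forall fun t => hC t trivial)
  have i2 : Integrable (fun t => a t * conj (pt t / (pt t - z))) ell :=
    ha.mul_bdd hc'.aestronglyMeasurable (Eventually.of_forall fun t => by
      rw [RCLike.norm_conj]; exact hC t trivial)
  -- The Poisson kernel is the Cauchy kernel plus its conjugate minus `1`. The conjugate kernel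
  -- contributes the conjugate of the Cauchy integral of `conj a`, whose coefficients of positive
  -- index vanish; only the mean survives, and the `-1` cancels it.
  have h2 : ∫ t, a t * conj (pt t / (pt t - z)) ∂ell = fourierCoeff a 0 := by
    have hs := hasSum_cauchyExt ha' hz
    have hs0 : HasSum (fun n : ℕ => fourierCoeff (fun t => conj (a t)) n * z ^ n)
        (conj (fourierCoeff a 0)) := by
      convert hasSum_single 0 ?_ using 1
      · simp [fourierCoeff_conj]
      · intro n hn
        rw [fourierCoeff_conj, hneg _ (by omega)]
        simp
    have := hs.unique hs0
    rw [cauchyExt_eq] at this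
    rw [← Complex.conj_conj (fourierCoeff a 0), ← this, ← integral_conj]
    simp
  have h3 : ∫ t, a t ∂ell = fourierCoeff a 0 := by simp [fourierCoeff]
  unfold poissonInt
  simp_rw [poissonKernel_eq hz]
  have : ∀ t, (pt t / (pt t - z) + conj (pt t / (pt t - z)) - 1) * a t =
      a t * (pt t / (pt t - z)) + a t * conj (pt t / (pt t - z)) - a t := fun t => by ring
  simp_rw [this]
  have i3 : Integrable (fun t => a t * (pt t / (pt t - z)) +
      a t * conj (pt t / (pt t - z))) ell := i1.add i2
  rw [integral_sub i3 ha, integral_add i1 i2, h2, h3, cauchyExt_eq]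
  ring

theorem integral_poissonKernel {z : ℂ} (hz : ‖z‖ < 1) : poissonInt (fun _ => 1) z = 1 := by
  have hcoef : ∀ n : ℤ, n ≠ 0 → fourierCoeff (fun _ : Torus => (1 : ℂ)) n = 0 := by
    intro n hn
    have h := fourierCoeff_fourier (T := 2 * Real.pi) 0
    have h2 : ⇑(fourier (T := 2 * Real.pi) 0) = fun _ => 1 := by ext; exact fourier_zero
    rw [h2] at h
    rw [h, Pi.single_eq_of_ne hn]
  rw [poissonInt_eq_cauchyExt (integrable_const _) (fun n hn => hcoef n hn.ne) hz]
  refine (hasSum_cauchyExt (integrable_const _) hz).unique ?_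
  convert hasSum_single 0 ?_ using 1
  · simp [fourierCoeff]
  · intro n hn
    rw [hcoef _ (by exact_mod_cast hn), zero_mul]

/-! ### Nontangential limits: Fatou's theorem -/

/-- Jordan's inequality `|sin x| ≥ 2|x|/π`, applied to half of the representative of `s - t` in
`[-π, π]`: the chord is comparable to the arc. -/
theorem dist_le_norm_pt_sub (s t : Torus) : dist s t ≤ Real.pi / 2 * ‖pt s - pt t‖ := by
  have hp : 0 < 2 * Real.pi := Real.two_pi_pos
  have h1 : ‖pt s - pt t‖ = ‖pt (s - t) - 1‖ := by
    have : pt s - pt t = pt t * (pt (s - t) - 1) := by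
      have : pt s = pt t * pt (s - t) := by
        unfold pt
        rw [← Circle.coe_mul, ← AddCircle.toCircle_add, add_sub_cancel]
      rw [mul_sub, ← this, mul_one]
    rw [this, norm_mul, norm_pt, one_mul]
  rw [h1, dist_eq_norm]
  induction hx : s - t using QuotientAddGroup.induction_on with
  | H x =>
  set k := round ((2 * Real.pi)⁻¹ * x) with hk
  set y := x - k * (2 * Real.pi) with hy
  have hxy : (x : Torus) = (y : Torus) := by
    rw [hy, AddCircle.coe_sub, ← zsmul_eq_mul, AddCircle.coe_zsmul, AddCircle.coe_period]
    simp
  have hn : ‖(x : Torus)‖ = |y| := AddCircle.norm_eq _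
  have hle : |y| ≤ Real.pi := by
    rw [← hn]
    have := AddCircle.norm_le_half_period (2 * Real.pi) hp.ne' (x := (x : Torus))
    rw [abs_of_pos hp] at this
    linarith
  change ‖(x : Torus)‖ ≤ Real.pi / 2 * ‖pt (x : Torus) - 1‖
  rw [hn, hxy]
  have e : pt (y : Torus) = Complex.exp (Complex.I * y) := by
    unfold pt
    rw [AddCircle.toCircle_apply_mk, Circle.coe_exp, div_self hp.ne', one_mul, mul_comm]
  rw [e, Complex.norm_exp_I_mul_ofReal_sub_one, norm_mul, Real.norm_eq_abs, Real.norm_eq_abs]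
  have := Real.mul_abs_le_abs_sin (x := y / 2) (by rw [abs_div, abs_two]; linarith)
  rw [abs_div, abs_two] at this
  rw [abs_two]
  have hpi := Real.pi_pos
  calc |y| = Real.pi / 2 * (2 * (2 / Real.pi * (|y| / 2))) := by field_simp
    _ ≤ _ := by gcongr

/-- In a Stolz region `‖pt s - z‖` dominates both `1 - ‖z‖` and a multiple of `dist s t`, so the
kernel decays like `4⁻ᵏ` on the `k`-th dyadic annulus about `t`. Finitely many balls suffice because
distances on the circle are at most `π`. -/
theorem poissonKernel_le_sum {α : ℝ} (hα : 1 < α) {t : Torus} {z : ℂ} (hz : z ∈ stolz α t) :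
    ∃ N : ℕ, ∀ s, poissonKernel z s ≤ ∑ k ∈ Finset.range N,
      (Metric.closedBall t (2 ^ k * (1 - ‖z‖))).indicator
        (fun _ => 8 * (Real.pi / 2 * (1 + α)) ^ 2 * (1 / 4) ^ k / (1 - ‖z‖)) s := by
  obtain ⟨hz1, hz2⟩ := hz
  set δ := 1 - ‖z‖ with hδ
  set D := Real.pi / 2 * (1 + α) with hD
  have hδ0 : 0 < δ := by linarith
  have hpi : 1 < Real.pi / 2 := by have := Real.pi_gt_three; linarith
  have hD1 : 1 ≤ D := by nlinarith
  obtain ⟨n, hn⟩ := pow_unbounded_of_one_lt (Real.pi / δ) (one_lt_two (α := ℝ))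
  have hdist : ∀ s : Torus, dist s t ≤ Real.pi := fun s => by
    rw [dist_eq_norm]
    have := AddCircle.norm_le_half_period (2 * Real.pi) Real.two_pi_pos.ne' (x := s - t)
    rw [abs_of_pos Real.two_pi_pos] at this
    linarith
  refine ⟨n + 1, fun s => ?_⟩
  have hsz : δ ≤ ‖pt s - z‖ := one_sub_norm_le s
  have hsz0 : 0 < ‖pt s - z‖ := hδ0.trans_le hsz
  have hst : dist s t ≤ D * ‖pt s - z‖ := by
    have h1 := dist_le_norm_pt_sub s t
    have h2 : ‖pt s - pt t‖ ≤ ‖pt s - z‖ + ‖z - pt t‖ := norm_sub_le_norm_sub_add_norm_sub _ _ _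
    have h3 : ‖z - pt t‖ ≤ α * ‖pt s - z‖ := hz2.le.trans (by gcongr)
    calc dist s t ≤ Real.pi / 2 * ‖pt s - pt t‖ := h1
      _ ≤ Real.pi / 2 * (‖pt s - z‖ + α * ‖pt s - z‖) := by gcongr; linarith
      _ = _ := by rw [hD]; ring
  have hP : poissonKernel z s ≤ 2 * δ / ‖pt s - z‖ ^ 2 := by
    unfold poissonKernel
    gcongr
    have := norm_nonneg z
    nlinarith
  have hex : ∃ k : ℕ, dist s t ≤ 2 ^ k * δ :=
    ⟨n, (hdist s).trans ((div_lt_iff₀ hδ0).mp hn).le⟩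
  classical
  have hk := Nat.find_spec hex
  have hkn : Nat.find hex < n + 1 :=
    Nat.lt_succ_of_le (Nat.find_min' hex ((hdist s).trans ((div_lt_iff₀ hδ0).mp hn).le))
  have hmin := fun m => Nat.find_min hex (m := m)
  generalize Nat.find hex = k at hk hkn hmin
  -- `k` is the least index whose ball contains `s`, so for `k = j + 1` the distance exceeds `2 ^ j
  -- * δ`. The `8` is the `2` of `hP` times the `4` lost in passing from `j` to `j + 1`.
  have hterm : poissonKernel z s ≤ 8 * D ^ 2 * (1 / 4) ^ k / δ := by
    refine hP.trans ?_
    rcases k with _ | j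
    · calc 2 * δ / ‖pt s - z‖ ^ 2 ≤ 2 * δ / δ ^ 2 := by gcongr
        _ = 2 / δ := by field_simp
        _ ≤ _ := by
          gcongr
          nlinarith
    · have hj := hmin j (Nat.lt_succ_self j)
      push Not at hj
      have h1 : 2 ^ j * δ / D ≤ ‖pt s - z‖ := by
        rw [div_le_iff₀ (by linarith)]
        linarith
      have h2 : 0 < 2 ^ j * δ / D := by positivity
      calc 2 * δ / ‖pt s - z‖ ^ 2 ≤ 2 * δ / (2 ^ j * δ / D) ^ 2 := by gcongr
        _ = _ := by
          have : (4 : ℝ) ^ j = (2 ^ j) ^ 2 := by rw [← pow_mul, mul_comm, pow_mul]; norm_num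
          rw [one_div, inv_pow, pow_succ 4, this]
          field_simp
          norm_num
  refine hterm.trans ?_
  have hmem : s ∈ Metric.closedBall t (2 ^ k * δ) := hk
  have hsingle := Finset.single_le_sum (s := Finset.range (n + 1)) (f := fun k =>
      (Metric.closedBall t (2 ^ k * δ)).indicator (fun _ => 8 * D ^ 2 * (1 / 4) ^ k / δ) s)
    (fun k _ => Set.indicator_nonneg (fun _ _ => by positivity) s) (Finset.mem_range.mpr hkn)
  simpa only [Set.indicator_of_mem hmem] using hsingle

theorem tendsto_one_sub_norm (α : ℝ) (t : Torus) :
    Tendsto (fun z : ℂ => 1 - ‖z‖) (𝓝[stolz α t] (pt t)) (𝓝[>] 0) := by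
  refine tendsto_nhdsWithin_iff.mpr ⟨?_, ?_⟩
  · have : Tendsto (fun z : ℂ => 1 - ‖z‖) (𝓝 (pt t)) (𝓝 (1 - ‖pt t‖)) :=
      (continuous_const.sub continuous_norm).tendsto _
    rw [norm_pt, sub_self] at this
    exact this.mono_left nhdsWithin_le_nhds
  · filter_upwards [self_mem_nhdsWithin] with z hz
    exact sub_pos.mpr hz.1

/-- The Poisson integral of a nonnegative function is controlled by its means over dyadic balls. -/
theorem integral_poissonKernel_mul_tendsto_zero {ψ : Torus → ℝ} (hψ : Integrable ψ ell)
    (hψ0 : ∀ s, 0 ≤ ψ s) {α : ℝ} (hα : 1 < α) (t : Torus)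
    (hlim : Tendsto (fun r => (∫ s in Metric.closedBall t r, ψ s ∂ell) / r) (𝓝[>] 0) (𝓝 0)) :
    Tendsto (fun z => ∫ s, poissonKernel z s * ψ s ∂ell) (𝓝[stolz α t] (pt t)) (𝓝 0) := by
  set B : ℝ → ℝ := fun r => (∫ s in Metric.closedBall t r, ψ s ∂ell) / r with hB
  set D := Real.pi / 2 * (1 + α) with hD
  have hI0 : ∀ r, 0 ≤ ∫ s in Metric.closedBall t r, ψ s ∂ell := fun r => integral_nonneg hψ0
  have hB0 : ∀ r, 0 < r → 0 ≤ B r := fun r hr => div_nonneg (hI0 r) hr.le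
  -- The means are bounded near `0` because they converge, and for `r ≥ r₀` by the total integral
  -- over `r₀`. This is the domination needed to let `z → pt t` inside the dyadic series; the
  -- weights are `4⁻ᵏ · 2ᵏ = 2⁻ᵏ`.
  obtain ⟨C, hC⟩ : ∃ C, ∀ r, 0 < r → B r ≤ C := by
    have h1 : ∀ᶠ r in 𝓝[>] (0 : ℝ), B r < 1 := hlim.eventually_lt_const one_pos
    obtain ⟨r₀, hr₀, h⟩ := mem_nhdsGT_iff_exists_Ioo_subset.mp h1
    refine ⟨max 1 ((∫ s, ψ s ∂ell) / r₀), fun r hr => ?_⟩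
    rcases lt_or_ge r r₀ with h' | h'
    · exact (h ⟨hr, h'⟩).le.trans (le_max_left _ _)
    · refine le_trans ?_ (le_max_right _ _)
      exact div_le_div₀ (integral_nonneg hψ0)
        (setIntegral_le_integral hψ (Eventually.of_forall hψ0)) hr₀ h'
  have hterm : Tendsto (fun z : ℂ => ∑' k : ℕ, 8 * D ^ 2 * (1 / 2) ^ k * B (2 ^ k * (1 - ‖z‖)))
      (𝓝[stolz α t] (pt t)) (𝓝 (∑' _ : ℕ, (0 : ℝ))) := by
    refine tendsto_tsum_of_dominated_convergence (bound := fun k => 8 * D ^ 2 * (1 / 2) ^ k * C)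
      ?_ ?_ ?_
    · exact (summable_geometric_two.mul_left _).mul_right _
    · intro k
      have h2 : Tendsto (fun z : ℂ => 2 ^ k * (1 - ‖z‖)) (𝓝[stolz α t] (pt t)) (𝓝[>] 0) := by
        have h3 : Tendsto (fun x : ℝ => 2 ^ k * x) (𝓝[>] 0) (𝓝[>] 0) := by
          refine tendsto_nhdsWithin_iff.mpr ⟨?_, ?_⟩
          · have : Tendsto (fun x : ℝ => 2 ^ k * x) (𝓝 0) (𝓝 (2 ^ k * 0)) :=
              (continuous_const.mul continuous_id).tendsto _
            rw [mul_zero] at this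
            exact this.mono_left nhdsWithin_le_nhds
          · filter_upwards [self_mem_nhdsWithin] with x hx
            have hx' : (0 : ℝ) < x := hx
            exact Set.mem_Ioi.mpr (by positivity)
        exact h3.comp (tendsto_one_sub_norm α t)
      simpa using (hlim.comp h2).const_mul (8 * D ^ 2 * (1 / 2) ^ k)
    · filter_upwards [self_mem_nhdsWithin] with z hz k
      have hδ : 0 < 2 ^ k * (1 - ‖z‖) := mul_pos (by positivity) (sub_pos.mpr hz.1)
      rw [Real.norm_of_nonneg (mul_nonneg (by positivity) (hB0 _ hδ))]
      gcongr
      exact hC _ hδ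
  rw [tsum_zero] at hterm
  refine squeeze_zero' ?_ ?_ hterm
  · filter_upwards [self_mem_nhdsWithin] with z hz
    exact integral_nonneg fun s => mul_nonneg (poissonKernel_nonneg hz.1 s) (hψ0 s)
  · filter_upwards [self_mem_nhdsWithin] with z hz
    obtain ⟨N, hN⟩ := poissonKernel_le_sum hα hz
    have hδ : 0 < 1 - ‖z‖ := sub_pos.mpr hz.1
    set c : ℕ → ℝ := fun k => 8 * D ^ 2 * (1 / 4) ^ k / (1 - ‖z‖) with hc
    have hle : ∀ s, poissonKernel z s * ψ s ≤ ∑ k ∈ Finset.range N,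
        c k * (Metric.closedBall t (2 ^ k * (1 - ‖z‖))).indicator ψ s := by
      intro s
      refine (mul_le_mul_of_nonneg_right (hN s) (hψ0 s)).trans_eq ?_
      rw [Finset.sum_mul]
      refine Finset.sum_congr rfl fun k _ => ?_
      by_cases hs : s ∈ Metric.closedBall t (2 ^ k * (1 - ‖z‖))
      · rw [Set.indicator_of_mem hs, Set.indicator_of_mem hs]
      · rw [Set.indicator_of_notMem hs, Set.indicator_of_notMem hs, zero_mul, mul_zero]
    have hint : ∀ k, Integrable (fun s =>
        c k * (Metric.closedBall t (2 ^ k * (1 - ‖z‖))).indicator ψ s) ell := fun k =>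
      (hψ.indicator Metric.isClosed_closedBall.measurableSet).const_mul _
    calc ∫ s, poissonKernel z s * ψ s ∂ell
        ≤ ∫ s, ∑ k ∈ Finset.range N,
          c k * (Metric.closedBall t (2 ^ k * (1 - ‖z‖))).indicator ψ s ∂ell :=
          integral_mono_of_nonneg
            (Eventually.of_forall fun s => mul_nonneg (poissonKernel_nonneg hz.1 s) (hψ0 s))
            (integrable_finsetSum _ fun k _ => hint k) (Eventually.of_forall hle)
      _ = ∑ k ∈ Finset.range N, 8 * D ^ 2 * (1 / 2) ^ k * B (2 ^ k * (1 - ‖z‖)) := by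
          rw [integral_finsetSum _ fun k _ => hint k]
          refine Finset.sum_congr rfl fun k _ => ?_
          rw [integral_const_mul, integral_indicator Metric.isClosed_closedBall.measurableSet]
          simp only [hc, hB]
          have : (4 : ℝ) ^ k = 2 ^ k * 2 ^ k := by rw [← mul_pow]; norm_num
          rw [one_div, one_div, inv_pow, inv_pow, this]
          field_simp
      _ ≤ _ := by
          refine Summable.sum_le_tsum _ (fun k _ => ?_) ?_
          · have h4 : 0 < 2 ^ k * (1 - ‖z‖) := by positivity
            exact mul_nonneg (by positivity) (hB0 _ h4)
          · refine Summable.of_nonneg_of_le (fun k => ?_) (fun k => ?_)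
              ((summable_geometric_two.mul_left (8 * D ^ 2)).mul_right C)
            · have h4 : 0 < 2 ^ k * (1 - ‖z‖) := by positivity
              exact mul_nonneg (by positivity) (hB0 _ h4)
            · have h4 : 0 < 2 ^ k * (1 - ‖z‖) := by positivity
              gcongr
              exact hC _ h4

theorem ae_ell_iff {p : Torus → Prop} : (∀ᵐ t ∂ell, p t) ↔ ∀ᵐ t ∂(volume : Measure Torus), p t := by
  rw [AddCircle.volume_eq_smul_haarAddCircle, Measure.ae_ennreal_smul_measure_iff]
  exact (ENNReal.ofReal_pos.mpr Real.two_pi_pos).ne'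

theorem integrable_ell_iff {a : Torus → ℂ} :
    Integrable a ell ↔ Integrable a (volume : Measure Torus) := by
  rw [← memLp_one_iff_integrable, ← memLp_one_iff_integrable, memLp_haarAddCircle_iff]

theorem ae_lebesgue_point {a : Torus → ℂ} (ha : Integrable a ell) : ∀ᵐ t ∂ell,
    Tendsto (fun r => (∫ s in Metric.closedBall t r, ‖a s - a t‖ ∂ell) / r) (𝓝[>] 0) (𝓝 0) := by
  rw [ae_ell_iff]
  have hloc : LocallyIntegrable a (volume : Measure Torus) :=
    (integrable_ell_iff.mp ha).locallyIntegrable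
  filter_upwards [IsUnifLocDoublingMeasure.ae_tendsto_average_norm_sub volume hloc 1] with t ht
  have h := ht (l := 𝓝[>] 0) (fun _ => t) id tendsto_id (by
    filter_upwards [self_mem_nhdsWithin] with r hr
    have : (0 : ℝ) < r := hr
    exact Metric.mem_closedBall_self (by simpa using this.le))
  -- The factor `1/π` arises because `volume` is `2π` times `ell` and a ball of radius `r` has
  -- volume at most `2r`.
  have h' := h.const_mul (1 / Real.pi)
  rw [mul_zero] at h'
  refine squeeze_zero' ?_ ?_ h'
  · filter_upwards [self_mem_nhdsWithin] with r hr
    exact div_nonneg (integral_nonneg fun s => norm_nonneg _) (le_of_lt hr)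
  · filter_upwards [self_mem_nhdsWithin] with r hr
    have hr : 0 < r := hr
    have e1 : ∫ s in Metric.closedBall t r, ‖a s - a t‖ =
        (2 * Real.pi) * ∫ s in Metric.closedBall t r, ‖a s - a t‖ ∂ell := by
      rw [AddCircle.volume_eq_smul_haarAddCircle, Measure.restrict_smul, integral_smul_measure,
        ENNReal.toReal_ofReal Real.two_pi_pos.le, smul_eq_mul]
    have e2 : (volume.real (Metric.closedBall t r)) *
        (⨍ s in Metric.closedBall t r, ‖a s - a t‖) =
        ∫ s in Metric.closedBall t r, ‖a s - a t‖ := by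
      have := measure_smul_setAverage (μ := (volume : Measure Torus))
        (fun s => ‖a s - a t‖) (s := Metric.closedBall t r) (measure_ne_top _ _)
      simpa only [smul_eq_mul] using this
    have e3 : volume.real (Metric.closedBall t r) ≤ 2 * r := by
      rw [measureReal_def, AddCircle.volume_closedBall]
      refine ENNReal.toReal_le_of_le_ofReal (by positivity) ?_
      exact ENNReal.ofReal_le_ofReal (min_le_right _ _)
    have e4 : 0 ≤ ⨍ s in Metric.closedBall t r, ‖a s - a t‖ :=
      integral_nonneg fun s => norm_nonneg _
    have e5 := mul_le_mul_of_nonneg_right e3 e4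
    rw [e2, e1] at e5
    have hpi := Real.pi_pos
    rw [div_le_iff₀ hr, one_div, id, mul_assoc, ← div_eq_inv_mul, le_div_iff₀ hpi]
    linarith

/-- **Fatou's theorem** for Poisson integrals. -/
theorem ae_tendsto_poissonInt {a : Torus → ℂ} (ha : Integrable a ell) :
    ∀ᵐ t ∂ell, Tendsto (poissonInt a) (ntFilter t) (𝓝 (a t)) := by
  filter_upwards [ae_lebesgue_point ha] with t ht
  unfold ntFilter
  rw [tendsto_iSup]
  rintro ⟨α, hα⟩
  have hint : Integrable (fun s => a s - a t) ell := ha.sub (integrable_const _)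
  have h := integral_poissonKernel_mul_tendsto_zero hint.norm (fun s => norm_nonneg _) hα t ht
  rw [tendsto_iff_norm_sub_tendsto_zero]
  refine squeeze_zero' (Eventually.of_forall fun z => norm_nonneg _) ?_ h
  filter_upwards [self_mem_nhdsWithin] with z hz
  have e : poissonInt a z - a t = ∫ s, poissonKernel z s * (a s - a t) ∂ell := by
    have h1 := integral_poissonKernel hz.1
    unfold poissonInt at h1 ⊢
    simp_rw [mul_one] at h1
    simp_rw [mul_sub]
    rw [integral_sub (integrable_poissonKernel_mul ha hz.1)
      (integrable_poissonKernel_mul (integrable_const _) hz.1), integral_mul_const, h1, one_mul]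
  rw [e]
  refine (norm_integral_le_integral_norm _).trans_eq ?_
  congr 1
  ext s
  rw [norm_mul, Complex.norm_real, Real.norm_of_nonneg (poissonKernel_nonneg hz.1 s)]

/-- Makes nontangential limits unique, so that `bdry` returns the limit when there is one. The
radial sequence lies in the region of aperture `2`. -/
instance ntFilter_neBot (t : Torus) : (ntFilter t).NeBot := by
  have h : (𝓝[stolz 2 t] (pt t)).NeBot := by
    rw [← mem_closure_iff_nhdsWithin_neBot, mem_closure_iff_seq_limit]
    refine ⟨fun n => ((1 - 1 / ((n : ℝ) + 2) : ℝ) : ℂ) * pt t, fun n => ?_, ?_⟩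
    · have h0 : (0 : ℝ) < n + 2 := by positivity
      have h1 : 0 < 1 / ((n : ℝ) + 2) := by positivity
      have h2 : 1 / ((n : ℝ) + 2) ≤ 1 := by rw [div_le_one h0]; linarith [n.cast_nonneg (α := ℝ)]
      have hn : ‖((1 - 1 / ((n : ℝ) + 2) : ℝ) : ℂ) * pt t‖ = 1 - 1 / ((n : ℝ) + 2) := by
        rw [norm_mul, norm_pt, mul_one, Complex.norm_real, Real.norm_of_nonneg (by linarith)]
      refine ⟨by rw [hn]; linarith, ?_⟩
      have : ((1 - 1 / ((n : ℝ) + 2) : ℝ) : ℂ) * pt t - pt t =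
          -((1 / ((n : ℝ) + 2) : ℝ) : ℂ) * pt t := by push_cast; ring
      rw [hn, this, norm_mul, norm_pt, norm_neg, Complex.norm_real, Real.norm_of_nonneg h1.le]
      linarith
    · have h1 : Tendsto (fun n : ℕ => 1 / ((n : ℝ) + 2)) atTop (𝓝 0) := by
        have := (tendsto_one_div_add_atTop_nhds_zero_nat (𝕜 := ℝ)).comp (tendsto_add_atTop_nat 1)
        refine this.congr fun n => ?_
        simp only [Function.comp_apply]
        push_cast
        ring_nf
      have h2 := ((Complex.continuous_ofReal.tendsto _).comp (h1.const_sub 1)).mul_const (pt t)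
      simpa using h2
  exact h.mono (le_iSup (fun α : {α : ℝ // 1 < α} => 𝓝[stolz α t] (pt t)) ⟨2, by norm_num⟩)

theorem ntFilter_eventually (t : Torus) : ∀ᶠ z in ntFilter t, ‖z‖ < 1 := by
  unfold ntFilter
  rw [eventually_iSup]
  intro α
  filter_upwards [self_mem_nhdsWithin] with z hz
  exact hz.1

/-! ### Functions of class `H²` on the circle: products and uniqueness -/

/-- A square integrable function whose Fourier coefficients of negative index vanish. -/
structure IsHardy (a : Torus → ℂ) : Prop where
  memLp : MemLp a 2 ell
  coeff : ∀ n : ℤ, n < 0 → fourierCoeff a n = 0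

theorem IsHardy.integrable {a : Torus → ℂ} (ha : IsHardy a) : Integrable a ell :=
  ha.memLp.integrable one_le_two

theorem IsHardy.congr {a b : Torus → ℂ} (ha : IsHardy a) (h : a =ᵐ[ell] b) : IsHardy b :=
  ⟨(memLp_congr_ae h).mp ha.memLp, fun n hn => by
    rw [← fourierCoeff_congr_ae h]; exact ha.coeff n hn⟩

theorem isHardy_coe {g : L2T} (hg : g ∈ H2) : IsHardy g := ⟨Lp.memLp g, hg⟩

theorem IsHardy.toLp_mem {a : Torus → ℂ} (ha : IsHardy a) : ha.memLp.toLp ∈ H2 := fun n hn => by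
  rw [fourierCoeff_congr_ae ha.memLp.coeFn_toLp]; exact ha.coeff n hn

theorem memLp_conj {a : Torus → ℂ} (ha : MemLp a 2 ell) : MemLp (fun t => conj (a t)) 2 ell :=
  ha.star

/-- Parseval's identity for `conj a` and `b`; the pairing is bilinear, hence the index `-k`. -/
theorem hasSum_integral_mul {a b : Torus → ℂ} (ha : MemLp a 2 ell) (hb : MemLp b 2 ell) :
    HasSum (fun k : ℤ => fourierCoeff a (-k) * fourierCoeff b k) (∫ t, a t * b t ∂ell) := by
  have hac := memLp_conj ha
  have h := fourierBasis.hasSum_inner_mul_inner hac.toLp hb.toLp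
  convert! h using 1
  · ext k
    rw [← inner_conj_symm, ← fourierBasis.repr_apply_apply, ← fourierBasis.repr_apply_apply,
      fourierBasis_repr, fourierBasis_repr, fourierCoeff_congr_ae hac.coeFn_toLp,
      fourierCoeff_congr_ae hb.coeFn_toLp, fourierCoeff_conj, Complex.conj_conj]
  · rw [L2.inner_def]
    refine integral_congr_ae ?_
    filter_upwards [hac.coeFn_toLp, hb.coeFn_toLp] with t h1 h2
    rw [h1, h2, RCLike.inner_apply', Complex.conj_conj]

theorem hasSum_fourierCoeff_mul {a b : Torus → ℂ} (ha : MemLp a 2 ell) (hb : MemLp b 2 ell)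
    (n : ℤ) : HasSum (fun k : ℤ => fourierCoeff a (n - k) * fourierCoeff b k)
      (fourierCoeff (fun t => a t * b t) n) := by
  have hc : MemLp (fun t => fourier (-n) t * a t) 2 ell := by
    refine ha.of_le_mul (c := 1)
      ((fourier (-n)).continuous.aestronglyMeasurable.mul ha.aestronglyMeasurable)
      (Eventually.of_forall fun t => ?_)
    rw [norm_mul, norm_fourier_apply]
  convert hasSum_integral_mul hc hb using 1
  · ext k
    congr 1
    simp only [fourierCoeff, smul_eq_mul]
    congr 1
    ext t
    rw [← mul_assoc, ← fourier_add]
    congr 3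
    ring
  · simp only [fourierCoeff, smul_eq_mul, mul_assoc]

theorem fourierCoeff_mul_of_neg {a b : Torus → ℂ} (ha : IsHardy a) (hb : IsHardy b) {n : ℤ}
    (hn : n < 0) : fourierCoeff (fun t => a t * b t) n = 0 := by
  refine (hasSum_fourierCoeff_mul ha.memLp hb.memLp n).unique ?_
  convert! hasSum_zero with k
  rcases lt_or_ge k 0 with hk | hk
  · rw [hb.coeff k hk, mul_zero]
  · rw [ha.coeff _ (by omega), zero_mul]

theorem fourierCoeff_mul_natCast {a b : Torus → ℂ} (ha : IsHardy a) (hb : IsHardy b) (n : ℕ) :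
    fourierCoeff (fun t => a t * b t) n =
      ∑ k ∈ Finset.range (n + 1), fourierCoeff b k * fourierCoeff a ((n - k : ℕ) : ℤ) := by
  refine (hasSum_fourierCoeff_mul ha.memLp hb.memLp n).unique ?_
  have h := hasSum_sum_of_ne_finset_zero (L := .unconditional ℤ)
    (f := fun k : ℤ => fourierCoeff a (n - k) * fourierCoeff b k)
    (s := (Finset.range (n + 1)).map Nat.castEmbedding) (fun k hk => ?_)
  · rw [Finset.sum_map] at h
    refine Eq.subst (motive := HasSum _) ?_ h
    refine Finset.sum_congr rfl fun k hk => ?_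
    rw [Finset.mem_range] at hk
    rw [mul_comm, Nat.cast_sub (by omega)]
    rfl
  · rcases lt_or_ge k 0 with hk0 | hk0
    · rw [hb.coeff k hk0, mul_zero]
    · rw [ha.coeff _ ?_, zero_mul]
      by_contra hcon
      apply hk
      rw [Finset.mem_map]
      exact ⟨k.toNat, Finset.mem_range.mpr (by omega), Int.toNat_of_nonneg hk0⟩

/-- The Cauchy product of the two power series. The product on the circle is only integrable in
general, which is enough for its Cauchy integral. -/
theorem cauchyExt_mul {a b : Torus → ℂ} (ha : IsHardy a) (hb : IsHardy b) {z : ℂ}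
    (hz : ‖z‖ < 1) : cauchyExt (fun t => a t * b t) z = cauchyExt a z * cauchyExt b z := by
  have hab : Integrable (fun t => a t * b t) ell := ha.memLp.integrable_mul hb.memLp
  have sa := hasSum_cauchyExt ha.integrable hz
  have sb := hasSum_cauchyExt hb.integrable hz
  refine (hasSum_cauchyExt hab hz).unique ?_
  have h := hasSum_sum_range_mul_of_summable_norm sb.summable.norm sa.summable.norm
  rw [sb.tsum_eq, sa.tsum_eq, mul_comm (cauchyExt b z)] at h
  convert! h using 1
  ext n
  rw [fourierCoeff_mul_natCast ha hb, Finset.sum_mul]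
  refine Finset.sum_congr rfl fun k hk => ?_
  have : z ^ n = z ^ k * z ^ (n - k) := by
    rw [← pow_add]; congr 1; rw [Finset.mem_range] at hk; omega
  rw [this]
  ring

theorem IsHardy.mul_bdd {a b : Torus → ℂ} (ha : IsHardy a) (hb : IsHardy b) {C : ℝ}
    (hC : ∀ᵐ t ∂ell, ‖b t‖ ≤ C) : IsHardy fun t => a t * b t := by
  refine ⟨ha.memLp.of_le_mul (c := C)
    (ha.memLp.aestronglyMeasurable.mul hb.memLp.aestronglyMeasurable) ?_,
    fun n hn => fourierCoeff_mul_of_neg ha hb hn⟩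
  filter_upwards [hC] with t ht
  rw [norm_mul, mul_comm]
  gcongr

theorem ae_eq_of_fourierCoeff_eq {a b : Torus → ℂ} (ha : MemLp a 2 ell) (hb : MemLp b 2 ell)
    (h : ∀ n, fourierCoeff a n = fourierCoeff b n) : a =ᵐ[ell] b := by
  have : ha.toLp = hb.toLp := by
    apply fourierBasis.repr.injective
    ext n
    rw [fourierBasis_repr, fourierBasis_repr, fourierCoeff_congr_ae ha.coeFn_toLp,
      fourierCoeff_congr_ae hb.coeFn_toLp, h]
  exact (MemLp.toLp_eq_toLp_iff ha hb).mp this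

/-- A member of `H²` is determined by its values in the disk. -/
theorem IsHardy.ae_eq_of_cauchyExt_eq {a b : Torus → ℂ} (ha : IsHardy a) (hb : IsHardy b)
    (h : ∀ z : ℂ, ‖z‖ < 1 → cauchyExt a z = cauchyExt b z) : a =ᵐ[ell] b := by
  refine ae_eq_of_fourierCoeff_eq ha.memLp hb.memLp fun n => ?_
  rcases lt_or_ge n 0 with hn | hn
  · rw [ha.coeff n hn, hb.coeff n hn]
  · have := fourierCoeff_eq_zero_of_hasSum
      (c := fun n : ℕ => fourierCoeff a n - fourierCoeff b n) (fun z hz => by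
        have := (hasSum_cauchyExt ha.integrable hz).sub (hasSum_cauchyExt hb.integrable hz)
        rw [h z hz, sub_self] at this
        simpa only [sub_mul] using this) n.toNat
    rwa [Int.toNat_of_nonneg hn, sub_eq_zero] at this

/-! ### Boundary functions of bounded holomorphic functions -/

/-- Parseval on the circle of radius `r < 1`, then `r → 1` in a finite sum. -/
theorem sum_sq_le_of_bounded {c : ℕ → ℂ} {h : ℂ → ℂ} {C : ℝ}
    (hs : ∀ z : ℂ, ‖z‖ < 1 → HasSum (fun n => c n * z ^ n) (h z))
    (hC : ∀ z : ℂ, ‖z‖ < 1 → ‖h z‖ ≤ C) (N : ℕ) :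
    ∑ n ∈ Finset.range N, ‖c n‖ ^ 2 ≤ C ^ 2 := by
  have key : ∀ r : ℝ, 0 ≤ r → r < 1 → ∑ n ∈ Finset.range N, ‖c n * r ^ n‖ ^ 2 ≤ C ^ 2 := by
    intro r hr0 hr1
    have hrz : ∀ t, ‖(r : ℂ) * pt t‖ < 1 := fun t => by
      rw [norm_mul, norm_pt, mul_one, Complex.norm_real, Real.norm_of_nonneg hr0]; exact hr1
    have h1 : ∀ t, HasSum (fun n => c n * (r : ℂ) ^ n * pt t ^ n) (h (r * pt t)) := fun t => by
      have := hs (r * pt t) (hrz t)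
      simpa only [mul_pow, mul_assoc] using this
    have h2 : Summable fun n => ‖c n * (r : ℂ) ^ n‖ := by
      have := (h1 0).summable.norm
      simpa only [norm_mul, norm_pow, norm_pt, one_pow, mul_one] using this
    have hcont : Continuous fun t => ∑' n, c n * (r : ℂ) ^ n * pt t ^ n := by
      refine continuous_tsum (fun n => continuous_const.mul (continuous_pt.pow n)) h2 fun n t => ?_
      rw [norm_mul _ (pt t ^ n), norm_pow (pt t), norm_pt, one_pow, mul_one]
    have hbd : ∀ t, ‖∑' n, c n * (r : ℂ) ^ n * pt t ^ n‖ ≤ C := fun t => by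
      rw [(h1 t).tsum_eq]; exact hC _ (hrz t)
    have hm : MemLp (fun t => ∑' n, c n * (r : ℂ) ^ n * pt t ^ n) 2 ell :=
      MemLp.of_bound hcont.aestronglyMeasurable C (Eventually.of_forall hbd)
    have hp := hasSum_sq_fourierCoeff hm.toLp
    have hle : ∫ t, ‖(hm.toLp : L2T) t‖ ^ 2 ∂ell ≤ C ^ 2 := by
      calc ∫ t, ‖(hm.toLp : L2T) t‖ ^ 2 ∂ell ≤ ∫ _, C ^ 2 ∂ell := by
            refine integral_mono_of_nonneg (Eventually.of_forall fun t => by positivity)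
              (integrable_const _) ?_
            filter_upwards [hm.coeFn_toLp] with t ht
            rw [ht]
            exact pow_le_pow_left₀ (norm_nonneg _) (hbd t) 2
        _ = C ^ 2 := by simp
    refine le_trans ?_ hle
    have hsum := sum_le_hasSum ((Finset.range N).map Nat.castEmbedding)
      (fun _ _ => by positivity) hp
    rw [Finset.sum_map, fourierCoeff_congr_ae hm.coeFn_toLp] at hsum
    refine le_trans (le_of_eq (Finset.sum_congr rfl fun n _ => ?_)) hsum
    rw [fourierCoeff_tsum h2, Nat.castEmbedding_apply, if_pos (Int.natCast_nonneg n),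
      Int.toNat_natCast]
  have hlim : Tendsto (fun r : ℝ => ∑ n ∈ Finset.range N, ‖c n * r ^ n‖ ^ 2) (𝓝[<] 1)
      (𝓝 (∑ n ∈ Finset.range N, ‖c n * (1 : ℝ) ^ n‖ ^ 2)) := by
    have hc : Continuous fun r : ℝ => ∑ n ∈ Finset.range N, ‖c n * (r : ℂ) ^ n‖ ^ 2 := by
      fun_prop
    simpa using (hc.tendsto 1).mono_left nhdsWithin_le_nhds
  simp only [Complex.ofReal_one, one_pow, mul_one] at hlim
  refine le_of_tendsto hlim ?_
  filter_upwards [Ioo_mem_nhdsLT (zero_lt_one (α := ℝ))] with r hr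
  exact key r hr.1.le hr.2

theorem exists_isHardy_of_summable_sq {c : ℕ → ℂ} (hc : Summable fun n => ‖c n‖ ^ 2) :
    ∃ a : Torus → ℂ, IsHardy a ∧ ∀ n : ℕ, fourierCoeff a n = c n := by
  set d : ℤ → ℂ := fun n => if 0 ≤ n then c n.toNat else 0 with hd
  have hsum : Summable fun n : ℤ => ‖d n‖ ^ 2 := by
    rw [← Nat.cast_injective (R := ℤ).summable_iff]
    · simpa [hd, Function.comp_def] using hc
    · intro n hn
      have : ¬ 0 ≤ n := fun h => hn ⟨n.toNat, Int.toNat_of_nonneg h⟩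
      simp [hd, this]
  have hmem : Memℓp d 2 := by
    rw [memℓp_gen_iff (by norm_num)]
    simpa using hsum
  have hco : ∀ n, fourierCoeff (fourierBasis.repr.symm (⟨d, hmem⟩ : lp (fun _ : ℤ => ℂ) 2) :
      Torus → ℂ) n = d n := fun n => by
    rw [← fourierBasis_repr, LinearIsometryEquiv.apply_symm_apply]
  refine ⟨_, ⟨Lp.memLp (fourierBasis.repr.symm (⟨d, hmem⟩ : lp (fun _ : ℤ => ℂ) 2)),
    fun n hn => ?_⟩, fun n => ?_⟩
  · rw [hco]; simp [hd, hn]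
  · rw [hco]; simp [hd]

/-- `a` is the boundary function of the holomorphic function `h` in the disk. -/
structure IsBoundary (h : ℂ → ℂ) (a : Torus → ℂ) : Prop where
  isHardy : IsHardy a
  cauchyExt_eq : ∀ z : ℂ, ‖z‖ < 1 → cauchyExt a z = h z
  tendsto : ∀ᵐ t ∂ell, Tendsto h (ntFilter t) (𝓝 (a t))

/-- The Taylor coefficients are square summable, hence are the Fourier coefficients of some `a` in
`H²`. The Poisson and Cauchy integrals of `a` both equal `h`, so Fatou's theorem gives the
nontangential limits. -/
theorem exists_isBoundary {h : ℂ → ℂ} (hd : DifferentiableOn ℂ h (Metric.ball 0 1)) {C : ℝ}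
    (hC : ∀ z : ℂ, ‖z‖ < 1 → ‖h z‖ ≤ C) : ∃ a, IsBoundary h a := by
  have hs : ∀ z : ℂ, ‖z‖ < 1 →
      HasSum (fun n : ℕ => (n.factorial : ℂ)⁻¹ * iteratedDeriv n h 0 * z ^ n) (h z) := by
    intro z hz
    have := Complex.hasSum_taylorSeries_on_ball hd (mem_ball_zero_iff.mpr hz)
    convert! this using 1
    ext n
    simp only [smul_eq_mul, sub_zero]
    ring
  obtain ⟨a, ha, hac⟩ := exists_isHardy_of_summable_sq
    (summable_of_sum_range_le (fun _ => by positivity) (sum_sq_le_of_bounded hs hC))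
  have hca : ∀ z : ℂ, ‖z‖ < 1 → cauchyExt a z = h z := fun z hz => by
    have := hasSum_cauchyExt ha.integrable hz
    simp_rw [hac] at this
    exact this.unique (hs z hz)
  refine ⟨a, ha, hca, ?_⟩
  filter_upwards [ae_tendsto_poissonInt ha.integrable] with t ht
  refine ht.congr' ?_
  filter_upwards [ntFilter_eventually t] with z hz
  rw [poissonInt_eq_cauchyExt ha.integrable ha.coeff hz, hca z hz]

theorem differentiableOn_cauchyExt {a : Torus → ℂ} (ha : Integrable a ell) :
    DifferentiableOn ℂ (cauchyExt a) (Metric.ball 0 1) := by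
  intro z hz
  rw [mem_ball_zero_iff] at hz
  obtain ⟨r, hzr, hr1⟩ := exists_between hz
  have hr0 : 0 ≤ r := (norm_nonneg z).trans hzr.le
  have hsum : Summable fun n : ℕ => ‖fourierCoeff a n‖ * r ^ n := by
    have h := (hasSum_cauchyExt ha (z := (r : ℂ))
      (by rwa [Complex.norm_real, Real.norm_of_nonneg hr0])).summable.norm
    simpa only [norm_mul, norm_pow, Complex.norm_real, Real.norm_of_nonneg hr0] using h
  have hd : DifferentiableOn ℂ (fun w => ∑' n : ℕ, fourierCoeff a n * w ^ n)
      (Metric.ball 0 r) := by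
    refine Complex.differentiableOn_tsum_of_summable_norm hsum (fun n => by fun_prop)
      Metric.isOpen_ball fun n w hw => ?_
    rw [mem_ball_zero_iff] at hw
    rw [norm_mul, norm_pow]
    gcongr
  have hd2 : DifferentiableOn ℂ (cauchyExt a) (Metric.ball 0 r) :=
    hd.congr fun w hw => by
      rw [mem_ball_zero_iff] at hw
      exact (hasSum_cauchyExt ha (hw.trans hr1)).tsum_eq.symm
  exact (hd2.differentiableAt
    (Metric.isOpen_ball.mem_nhds (mem_ball_zero_iff.mpr hzr))).differentiableWithinAt

/-! ### Herglotz integrals and bounded outer functions -/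

/-- The Herglotz integral of a real function of the circle. -/
noncomputable def herglotz (φ : Torus → ℝ) (z : ℂ) : ℂ :=
  ∫ t, (pt t + z) / (pt t - z) * (φ t : ℂ) ∂ell

/-- The outer function whose boundary modulus is `exp φ`. -/
noncomputable def expHerglotz (φ : Torus → ℝ) (z : ℂ) : ℂ := Complex.exp (herglotz φ z)

theorem integrable_herglotz {φ : Torus → ℝ} (hφ : Integrable φ ell) {z : ℂ} (hz : ‖z‖ < 1) :
    Integrable (fun t => (pt t + z) / (pt t - z) * (φ t : ℂ)) ell := by
  have hc : Continuous fun t => (pt t + z) / (pt t - z) :=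
    (continuous_pt.add continuous_const).div (continuous_pt.sub continuous_const)
      (pt_sub_ne_zero hz)
  obtain ⟨C, hC⟩ := isCompact_univ.exists_bound_of_continuousOn hc.continuousOn
  exact hφ.ofReal.bdd_mul hc.aestronglyMeasurable (Eventually.of_forall fun t => hC t trivial)

theorem herglotz_add {φ ψ : Torus → ℝ} (hφ : Integrable φ ell) (hψ : Integrable ψ ell) {z : ℂ}
    (hz : ‖z‖ < 1) : herglotz (fun t => φ t + ψ t) z = herglotz φ z + herglotz ψ z := by
  unfold herglotz
  rw [← integral_add (integrable_herglotz hφ hz) (integrable_herglotz hψ hz)]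
  congr 1
  ext t
  push_cast
  ring

theorem expHerglotz_add {φ ψ : Torus → ℝ} (hφ : Integrable φ ell) (hψ : Integrable ψ ell) {z : ℂ}
    (hz : ‖z‖ < 1) :
    expHerglotz (fun t => φ t + ψ t) z = expHerglotz φ z * expHerglotz ψ z := by
  unfold expHerglotz
  rw [herglotz_add hφ hψ hz, Complex.exp_add]

theorem herglotz_eq {φ : Torus → ℝ} (hφ : Integrable φ ell) {z : ℂ} (hz : ‖z‖ < 1) :
    herglotz φ z = 2 * cauchyExt (fun t => (φ t : ℂ)) z - ∫ t, (φ t : ℂ) ∂ell := by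
  have hc := continuous_pt_div hz
  obtain ⟨C, hC⟩ := isCompact_univ.exists_bound_of_continuousOn hc.continuousOn
  have i1 : Integrable (fun t => (φ t : ℂ) * (pt t / (pt t - z))) ell :=
    hφ.ofReal.mul_bdd hc.aestronglyMeasurable (Eventually.of_forall fun t => hC t trivial)
  have i2 : Integrable (fun t => 2 * ((φ t : ℂ) * (pt t / (pt t - z)))) ell := i1.const_mul 2
  have i3 : Integrable (fun t => (φ t : ℂ)) ell := hφ.ofReal
  rw [cauchyExt_eq, ← integral_const_mul, ← integral_sub i2 i3]
  refine integral_congr_ae (Eventually.of_forall fun t => ?_)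
  have := pt_sub_ne_zero hz t
  change (pt t + z) / (pt t - z) * (φ t : ℂ) = 2 * (φ t * (pt t / (pt t - z))) - φ t
  field_simp
  ring

theorem differentiableOn_expHerglotz {φ : Torus → ℝ} (hφ : Integrable φ ell) :
    DifferentiableOn ℂ (expHerglotz φ) (Metric.ball 0 1) := by
  refine DifferentiableOn.cexp ?_
  refine DifferentiableOn.congr (f := fun z =>
    2 * cauchyExt (fun t => (φ t : ℂ)) z - ∫ t, (φ t : ℂ) ∂ell) ?_ fun z hz =>
      herglotz_eq hφ (mem_ball_zero_iff.mp hz)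
  exact ((differentiableOn_cauchyExt hφ.ofReal).const_mul 2).sub_const _

theorem poissonInt_ofReal (φ : Torus → ℝ) (z : ℂ) :
    poissonInt (fun t => (φ t : ℂ)) z = (∫ t, poissonKernel z t * φ t ∂ell : ℝ) := by
  unfold poissonInt
  rw [← integral_complex_ofReal]
  simp

theorem herglotz_re {φ : Torus → ℝ} (hφ : Integrable φ ell) {z : ℂ} (hz : ‖z‖ < 1) :
    (herglotz φ z).re = ∫ t, poissonKernel z t * φ t ∂ell := by
  unfold herglotz
  have h := integral_re (integrable_herglotz hφ hz)
  simp only [RCLike.re_to_complex] at h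
  rw [← h]
  refine integral_congr_ae (Eventually.of_forall fun t => ?_)
  simp only [Complex.re_mul_ofReal, poissonKernel_eq_re hz]

theorem norm_expHerglotz {φ : Torus → ℝ} (hφ : Integrable φ ell) {z : ℂ} (hz : ‖z‖ < 1) :
    ‖expHerglotz φ z‖ = Real.exp (∫ t, poissonKernel z t * φ t ∂ell) := by
  unfold expHerglotz
  rw [Complex.norm_exp, herglotz_re hφ hz]

theorem integrable_poissonKernel_mul_real {φ : Torus → ℝ} (hφ : Integrable φ ell) {z : ℂ}
    (hz : ‖z‖ < 1) : Integrable (fun t => poissonKernel z t * φ t) ell := by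
  have hc := continuous_poissonKernel hz
  obtain ⟨C, hC⟩ := isCompact_univ.exists_bound_of_continuousOn hc.continuousOn
  exact hφ.bdd_mul hc.aestronglyMeasurable (Eventually.of_forall fun t => hC t trivial)

theorem norm_expHerglotz_le {φ : Torus → ℝ} (hφ : Integrable φ ell) {c : ℝ}
    (hc : ∀ᵐ t ∂ell, φ t ≤ c) {z : ℂ} (hz : ‖z‖ < 1) : ‖expHerglotz φ z‖ ≤ Real.exp c := by
  rw [norm_expHerglotz hφ hz, Real.exp_le_exp]
  have h1 : ∫ t, poissonKernel z t * c ∂ell = c := by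
    have h := integral_poissonKernel hz
    have h2 := poissonInt_ofReal (fun _ => 1) z
    simp only [Complex.ofReal_one, h, mul_one] at h2
    rw [integral_mul_const, ← Complex.ofReal_injective h2, one_mul]
  rw [← h1]
  refine integral_mono_ae (integrable_poissonKernel_mul_real hφ hz)
    (integrable_poissonKernel_mul_real (integrable_const c) hz) ?_
  filter_upwards [hc] with t ht
  exact mul_le_mul_of_nonneg_left ht (poissonKernel_nonneg hz t)

theorem ae_tendsto_norm_expHerglotz {φ : Torus → ℝ} (hφ : Integrable φ ell) :
    ∀ᵐ t ∂ell, Tendsto (fun z => ‖expHerglotz φ z‖) (ntFilter t) (𝓝 (Real.exp (φ t))) := by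
  filter_upwards [ae_tendsto_poissonInt hφ.ofReal] with t ht
  have h1 := (Complex.continuous_re.tendsto _).comp ht
  refine (((Real.continuous_exp.tendsto _).comp h1)).congr' ?_
  filter_upwards [ntFilter_eventually t] with z hz
  rw [norm_expHerglotz hφ hz]
  have := poissonInt_ofReal φ z
  simp only [Function.comp_apply, RCLike.ofReal_eq_complex_ofReal] at this ⊢
  rw [this, Complex.ofReal_re]

theorem exists_isBoundary_expHerglotz {φ : Torus → ℝ} (hφ : Integrable φ ell) {c : ℝ}
    (hc : ∀ᵐ t ∂ell, φ t ≤ c) : ∃ a, IsBoundary (expHerglotz φ) a :=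
  exists_isBoundary (differentiableOn_expHerglotz hφ) fun _ hz => norm_expHerglotz_le hφ hc hz

theorem IsBoundary.norm_eq_exp {φ : Torus → ℝ} (hφ : Integrable φ ell) {a : Torus → ℂ}
    (ha : IsBoundary (expHerglotz φ) a) : ∀ᵐ t ∂ell, ‖a t‖ = Real.exp (φ t) := by
  filter_upwards [ha.tendsto, ae_tendsto_norm_expHerglotz hφ] with t h1 h2
  exact tendsto_nhds_unique h1.norm h2

theorem IsBoundary.norm_le_exp {φ : Torus → ℝ} (hφ : Integrable φ ell) {a : Torus → ℂ}
    (ha : IsBoundary (expHerglotz φ) a) {c : ℝ} (hc : ∀ᵐ t ∂ell, φ t ≤ c) :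
    ∀ᵐ t ∂ell, ‖a t‖ ≤ Real.exp c := by
  filter_upwards [ha.norm_eq_exp hφ, hc] with t h1 h2
  rw [h1]
  exact Real.exp_le_exp.mpr h2

theorem IsBoundary.mul_ae_eq {h₁ h₂ h₃ : ℂ → ℂ} {a b c : Torus → ℂ} (ha : IsBoundary h₁ a)
    (hb : IsBoundary h₂ b) (hc : IsBoundary h₃ c)
    (h : ∀ z : ℂ, ‖z‖ < 1 → h₁ z * h₂ z = h₃ z) : ∀ᵐ t ∂ell, a t * b t = c t := by
  filter_upwards [ha.tendsto, hb.tendsto, hc.tendsto] with t h1 h2 h3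
  refine tendsto_nhds_unique ((h1.mul h2).congr' ?_) h3
  filter_upwards [ntFilter_eventually t] with z hz using h z hz

/-- Both sides are the value at the origin. This equality, characteristic of outer functions, is
what drives the approximate inverses below. -/
theorem IsBoundary.integral_eq {φ : Torus → ℝ} {a : Torus → ℂ}
    (ha : IsBoundary (expHerglotz φ) a) :
    ∫ t, a t ∂ell = (Real.exp (∫ t, φ t ∂ell) : ℝ) := by
  have h : cauchyExt a 0 = expHerglotz φ 0 := ha.cauchyExt_eq 0 (by simp)
  rw [HardyDual.cauchyExt_eq] at h
  have e1 : ∀ t, a t * (pt t / (pt t - 0)) = a t := fun t => by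
    rw [sub_zero, div_self (pt_ne_zero t), mul_one]
  have e2 : herglotz φ 0 = (∫ t, φ t ∂ell : ℝ) := by
    unfold herglotz
    rw [← integral_complex_ofReal]
    congr 1
    ext t
    rw [add_zero, sub_zero, div_self (pt_ne_zero t), one_mul]
  have h' : ∫ t, a t ∂ell = expHerglotz φ 0 := by simpa only [e1] using h
  rw [h', expHerglotz, e2, Complex.ofReal_exp]

/-- From `|a| ≤ 1` one gets `|a - 1|² ≤ 2 - 2 Re a`, and the mean of `a` is `exp ∫ φ`. Thus `a` is
close to `1` in `L²` as soon as `∫ φ` is close to `0`. -/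
theorem integral_norm_sub_one_sq_le {φ : Torus → ℝ} (hφ : Integrable φ ell)
    (h0 : ∀ t, φ t ≤ 0) {a : Torus → ℂ} (ha : IsBoundary (expHerglotz φ) a) :
    ∫ t, ‖a t - 1‖ ^ 2 ∂ell ≤ 2 - 2 * Real.exp (∫ t, φ t ∂ell) := by
  have hle := ha.norm_le_exp hφ (Eventually.of_forall h0)
  rw [Real.exp_zero] at hle
  have hint := ha.isHardy.integrable
  have hre : ∫ t, (a t).re ∂ell = Real.exp (∫ t, φ t ∂ell) := by
    have h := integral_re hint
    simp only [RCLike.re_to_complex] at h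
    rw [h, ha.integral_eq, Complex.ofReal_re]
  have hire : Integrable (fun t => (a t).re) ell := hint.re
  calc ∫ t, ‖a t - 1‖ ^ 2 ∂ell ≤ ∫ t, (2 - 2 * (a t).re) ∂ell := by
        refine integral_mono_of_nonneg (Eventually.of_forall fun t => by positivity)
          ((integrable_const _).sub (hire.const_mul 2)) ?_
        filter_upwards [hle] with t ht
        have h1 : ‖a t‖ ^ 2 ≤ 1 := pow_le_one₀ (norm_nonneg _) ht
        rw [← Complex.normSq_eq_norm_sq, Complex.normSq_apply] at h1 ⊢
        simp only [Complex.sub_re, Complex.sub_im, Complex.one_re, Complex.one_im]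
        nlinarith
    _ = _ := by
        rw [integral_sub (integrable_const _) (hire.const_mul 2), integral_const_mul, hre]
        simp

theorem tendsto_integral_max_sub_natCast {φ : Torus → ℝ} (hφ : Integrable φ ell) :
    Tendsto (fun j : ℕ => ∫ t, -max (φ t - j) 0 ∂ell) atTop (𝓝 0) := by
  have h := tendsto_integral_of_dominated_convergence (μ := ell)
    (F := fun (j : ℕ) t => -max (φ t - j) 0) (f := fun _ => 0) (fun t => ‖φ t‖)
    (fun j => by fun_prop (disch := exact hφ.aestronglyMeasurable)) hφ.norm
    (fun j => Eventually.of_forall fun t => ?_) (Eventually.of_forall fun t => ?_)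
  · simpa using h
  · rw [norm_neg, Real.norm_of_nonneg (le_max_right _ _), Real.norm_eq_abs]
    refine max_le ?_ (abs_nonneg _)
    have := le_abs_self (φ t)
    have := j.cast_nonneg (α := ℝ)
    linarith
  · obtain ⟨n, hn⟩ := exists_nat_ge (φ t)
    refine tendsto_const_nhds.congr' ?_
    filter_upwards [eventually_ge_atTop n] with j hj
    have : (n : ℝ) ≤ j := by exact_mod_cast hj
    rw [max_eq_right (by linarith), neg_zero]

theorem eLpNorm_two_eq {α : Type*} [MeasurableSpace α] {E : Type*}
    [NormedAddCommGroup E] {ν : Measure α} {a : α → E}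
    (ha : MemLp a 2 ν) : eLpNorm a 2 ν = ENNReal.ofReal (√(∫ t, ‖a t‖ ^ 2 ∂ν)) := by
  rw [ha.eLpNorm_eq_integral_rpow_norm two_ne_zero ENNReal.ofNat_ne_top, Real.sqrt_eq_rpow]
  norm_num

/-! ### Approximate inverses and quotients of outer functions -/

/-- Bounded outer functions are approximately invertible by bounded analytic functions. -/
theorem exists_approx_inverse {φ : Torus → ℝ} (hφ : Integrable φ ell)
    {k : Torus → ℂ} (hk : IsBoundary (expHerglotz fun t => -φ t) k) :
    ∃ q : ℕ → Torus → ℂ, (∀ j, IsHardy (q j) ∧ ∃ C : ℝ, ∀ᵐ t ∂ell, ‖q j t‖ ≤ C) ∧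
      (∀ j, ∀ᵐ t ∂ell, ‖k t * q j t‖ ≤ 1) ∧
      ∀ᵐ t ∂ell, Tendsto (fun j => k t * q j t) atTop (𝓝 1) := by
  have hmin : ∀ j : ℕ, Integrable (fun t => min (φ t) j) ell := fun j =>
    hφ.inf (integrable_const _)
  have hmax : ∀ j : ℕ, Integrable (fun t => -max (φ t - j) 0) ell := fun j =>
    ((hφ.sub (integrable_const _)).sup (integrable_const _)).neg
  have hmin_le : ∀ j : ℕ, ∀ᵐ t ∂ell, min (φ t) j ≤ (j : ℝ) := fun j =>
    Eventually.of_forall fun t => min_le_right _ _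
  have hmax_le : ∀ (j : ℕ) (t : Torus), -max (φ t - j) 0 ≤ 0 := fun j t => by
    rw [neg_nonpos]; exact le_max_right _ _
  -- The exact inverse of `k` has log-modulus `φ`, possibly unbounded above. Truncating to `min φ j`
  -- makes `q j` bounded, and `k q j = p j` has log-modulus `-(φ - j)⁺ ≤ 0`, whose integral tends to
  -- `0`.
  choose q hq using fun j => exists_isBoundary_expHerglotz (hmin j) (hmin_le j)
  choose p hp using fun j =>
    exists_isBoundary_expHerglotz (hmax j) (Eventually.of_forall (hmax_le j))
  have hkq : ∀ j, ∀ᵐ t ∂ell, k t * q j t = p j t := fun j => by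
    refine hk.mul_ae_eq (hq j) (hp j) fun z hz => ?_
    rw [← expHerglotz_add (φ := fun t => -φ t) hφ.neg (hmin j) hz]
    congr 2
    ext t
    rcases le_total (φ t) j with h | h
    · rw [min_eq_left h, max_eq_right (by linarith)]; ring
    · rw [min_eq_right h, max_eq_left (by linarith)]; ring
  have hL2 : Tendsto (fun j => ∫ t, ‖p j t - 1‖ ^ 2 ∂ell) atTop (𝓝 0) := by
    refine squeeze_zero (fun j => integral_nonneg fun t => by positivity)
      (fun j => integral_norm_sub_one_sq_le (hmax j) (hmax_le j) (hp j)) ?_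
    have h := (Real.continuous_exp.tendsto _).comp (tendsto_integral_max_sub_natCast hφ)
    have h2 := (h.const_mul 2).const_sub 2
    simpa using h2
  have hmeas : TendstoInMeasure ell p atTop fun _ => 1 := by
    refine tendstoInMeasure_of_tendsto_eLpNorm two_ne_zero
      (fun j => (hp j).isHardy.memLp.aestronglyMeasurable) aestronglyMeasurable_const ?_
    have e : ∀ j, eLpNorm (p j - fun _ => 1) 2 ell =
        ENNReal.ofReal (√(∫ t, ‖p j t - 1‖ ^ 2 ∂ell)) := fun j =>
      eLpNorm_two_eq ((hp j).isHardy.memLp.sub (memLp_const 1))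
    simp_rw [e]
    simpa using ENNReal.tendsto_ofReal ((Real.continuous_sqrt.tendsto _).comp hL2)
  -- Convergence in `L²` yields a.e. convergence only along a subsequence, which replaces `q`.
  obtain ⟨ns, -, hns⟩ := hmeas.exists_seq_tendsto_ae
  refine ⟨fun j => q (ns j), fun j => ⟨(hq _).isHardy, _, (hq _).norm_le_exp (hmin _) (hmin_le _)⟩,
    fun j => ?_, ?_⟩
  · filter_upwards [hkq (ns j), (hp (ns j)).norm_le_exp (hmax _)
      (Eventually.of_forall (hmax_le _))] with t h1 h2
    rw [h1]
    rwa [Real.exp_zero] at h2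
  · filter_upwards [hns, ae_all_iff.mpr hkq] with t h1 h2
    simpa only [h2] using h1

/-- An `L²` quotient of a function of `H²` by a bounded outer function belongs to `H²`. -/
theorem isHardy_of_outer_mul {φ : Torus → ℝ} (hφ : Integrable φ ell)
    {k : Torus → ℂ} (hk : IsBoundary (expHerglotz fun t => -φ t) k) {F : Torus → ℂ}
    (hF : MemLp F 2 ell) (hkF : IsHardy fun t => k t * F t) : IsHardy F := by
  obtain ⟨q, hq, hle, hlim⟩ := exists_approx_inverse hφ hk
  refine ⟨hF, fun n hn => ?_⟩
  have hFi : Integrable F ell := hF.integrable one_le_two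
  -- `(kF) q j` is a product of two functions of `H²`, so its coefficient of index `n < 0` vanishes.
  -- It converges a.e. to `F` and is dominated by `|F|`, so the vanishing passes to `F`.
  have h := tendsto_integral_of_dominated_convergence (μ := ell)
    (F := fun j t => fourier (-n) t • (k t * F t * q j t)) (f := fun t => fourier (-n) t • F t)
    (fun t => ‖F t‖) (fun j => ?_) hFi.norm (fun j => ?_) ?_
  · refine tendsto_nhds_unique h ?_
    refine tendsto_const_nhds.congr fun j => ?_
    exact (fourierCoeff_mul_of_neg hkF (hq j).1 hn).symm
  · exact (fourier (-n)).continuous.aestronglyMeasurable.smul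
      (hkF.memLp.aestronglyMeasurable.mul (hq j).1.memLp.aestronglyMeasurable)
  · filter_upwards [hle j] with t ht
    have e : k t * F t * q j t = k t * q j t * F t := by ring
    rw [norm_smul, norm_fourier_apply, one_mul, e, norm_mul]
    exact mul_le_of_le_one_left (norm_nonneg _) ht
  · filter_upwards [hlim] with t ht
    refine Tendsto.const_smul ?_ _
    have e : ∀ j, k t * F t * q j t = k t * q j t * F t := fun j => by ring
    simp_rw [e]
    simpa using ht.mul_const (F t)

/-- Boundary behaviour of an outer function, as a quotient of bounded outer functions. -/
theorem exists_boundary_quotient {φ : Torus → ℝ} (hφ : Integrable φ ell) :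
    ∃ k l : Torus → ℂ, IsBoundary (expHerglotz fun t => -max (φ t) 0) k ∧
      IsBoundary (expHerglotz fun t => -max (-φ t) 0) l ∧
      (∀ᵐ t ∂ell, k t ≠ 0) ∧ (∀ᵐ t ∂ell, ‖k t‖ ≤ 1) ∧ (∀ᵐ t ∂ell, ‖l t‖ ≤ 1) ∧
      (∀ᵐ t ∂ell, k t * bdry (expHerglotz φ) t = l t) ∧
      ∀ᵐ t ∂ell, ‖bdry (expHerglotz φ) t‖ = Real.exp (φ t) := by
  have h1 : Integrable (fun t => -max (φ t) 0) ell := (hφ.sup (integrable_const 0)).neg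
  have h2 : Integrable (fun t => -max (-φ t) 0) ell := (hφ.neg.sup (integrable_const 0)).neg
  have h1' : ∀ᵐ t ∂ell, -max (φ t) 0 ≤ 0 := Eventually.of_forall fun t => by
    rw [neg_nonpos]; exact le_max_right _ _
  have h2' : ∀ᵐ t ∂ell, -max (-φ t) 0 ≤ 0 := Eventually.of_forall fun t => by
    rw [neg_nonpos]; exact le_max_right _ _
  obtain ⟨k, hk⟩ := exists_isBoundary_expHerglotz h1 h1'
  obtain ⟨l, hl⟩ := exists_isBoundary_expHerglotz h2 h2'
  have hk1 := hk.norm_le_exp h1 h1'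
  have hl1 := hl.norm_le_exp h2 h2'
  rw [Real.exp_zero] at hk1 hl1
  have hk0 : ∀ᵐ t ∂ell, k t ≠ 0 := by
    filter_upwards [hk.norm_eq_exp h1] with t ht
    rw [← norm_ne_zero_iff, ht]
    exact (Real.exp_pos _).ne'
  -- From `φ = φ⁺ - φ⁻`, the outer function is the quotient of those with log-moduli `-φ⁻` and
  -- `-φ⁺`. Both are bounded by `1`, so limits exist even if the quotient is unbounded.
  have hb : ∀ᵐ t ∂ell, Tendsto (expHerglotz φ) (ntFilter t) (𝓝 (l t / k t)) := by
    filter_upwards [hk.tendsto, hl.tendsto, hk0] with t htk htl ht0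
    refine (htl.div htk ht0).congr' ?_
    filter_upwards [ntFilter_eventually t] with z hz
    have hne : expHerglotz (fun t => -max (φ t) 0) z ≠ 0 := Complex.exp_ne_zero _
    rw [Pi.div_apply, div_eq_iff hne, ← expHerglotz_add hφ h1 hz]
    congr 2
    ext t
    rcases le_total (φ t) 0 with h | h
    · rw [max_eq_right h, max_eq_left (by linarith)]; ring
    · rw [max_eq_left h, max_eq_right (by linarith)]; ring
  refine ⟨k, l, hk, hl, hk0, hk1, hl1, ?_, ?_⟩
  · filter_upwards [hb, hk0] with t ht h0
    rw [bdry, ht.limUnder_eq, mul_div_cancel₀ _ h0]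
  · filter_upwards [hb, ae_tendsto_norm_expHerglotz hφ] with t ht hn
    rw [bdry, ht.limUnder_eq]
    exact tendsto_nhds_unique ht.norm hn

/-! ### The anti-analytic projection and the distance to `H²` -/

theorem norm_sq_eq_integral (x : L2T) : ‖x‖ ^ 2 = ∫ t, ‖x t‖ ^ 2 ∂ell := by
  rw [Lp.norm_def, eLpNorm_two_eq (Lp.memLp x), ENNReal.toReal_ofReal (Real.sqrt_nonneg _),
    Real.sq_sqrt (integral_nonneg fun t => by positivity)]

/-- The series defining `Pminus` is a subfamily of the Fourier series, hence summable in `L²`, so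
its `tsum` is not the default value. -/
theorem fourierCoeff_Pminus (u : L2T) (n : ℤ) :
    fourierCoeff (Pminus u : Torus → ℂ) n = if n < 0 then fourierCoeff (u : Torus → ℂ) n else 0 := by
  have hs := (hasSum_fourier_series_L2 u).summable.indicator {n | n < 0}
  have e : (fun n : ℤ => if n < 0 then fourierCoeff (u : Torus → ℂ) n •
      fourierLp (T := 2 * Real.pi) 2 n else 0) =
      {n : ℤ | n < 0}.indicator fun n => fourierCoeff (u : Torus → ℂ) n • fourierLp 2 n := by
    ext1 m
    rw [Set.indicator_apply]
    rfl
  rw [← fourierBasis_repr, fourierBasis.repr_apply_apply, Pminus, e]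
  have hsum := (innerSL ℂ (fourierBasis (T := 2 * Real.pi) n)).hasSum hs.hasSum
  simp only [innerSL_apply_apply] at hsum
  rw [← hsum.tsum_eq, tsum_eq_single n]
  · rw [Set.indicator_apply, coe_fourierBasis]
    simp only [Set.mem_ofPred_eq]
    split_ifs
    · rw [inner_smul_right, orthonormal_iff_ite.mp orthonormal_fourier, if_pos rfl, mul_one]
    · exact inner_zero_right _
  · intro m hm
    rw [Set.indicator_apply, coe_fourierBasis]
    split_ifs
    · rw [inner_smul_right, orthonormal_iff_ite.mp orthonormal_fourier, if_neg hm.symm, mul_zero]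
    · exact inner_zero_right _

theorem fourierCoeff_coe_sub (x y : L2T) (n : ℤ) : fourierCoeff (x - y : L2T) n =
    fourierCoeff (x : Torus → ℂ) n - fourierCoeff (y : Torus → ℂ) n := by
  simp only [← fourierBasis_repr, map_sub]
  rfl

theorem sub_Pminus_mem (u : L2T) : u - Pminus u ∈ H2 := fun n hn => by
  rw [fourierCoeff_coe_sub, fourierCoeff_Pminus, if_pos hn, sub_self]

theorem sub_mem_H2 {x y : L2T} (hx : x ∈ H2) (hy : y ∈ H2) : x - y ∈ H2 := fun n hn => by
  rw [fourierCoeff_coe_sub, hx n hn, hy n hn, sub_self]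

theorem inner_Pminus_eq_zero (u : L2T) {x : L2T} (hx : x ∈ H2) : inner ℂ (Pminus u) x = 0 := by
  refine (fourierBasis.hasSum_inner_mul_inner (Pminus u) x).unique ?_
  convert! hasSum_zero with n
  rw [← inner_conj_symm, ← fourierBasis.repr_apply_apply, ← fourierBasis.repr_apply_apply,
    fourierBasis_repr, fourierBasis_repr, fourierCoeff_Pminus]
  split_ifs with h
  · rw [hx n h, mul_zero]
  · rw [map_zero, zero_mul]

/-- The squared distance from `u` to a member of `H²`. -/
theorem norm_sub_sq_eq (u : L2T) {x : L2T} (hx : x ∈ H2) :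
    ‖u - x‖ ^ 2 = ‖Pminus u‖ ^ 2 + ‖u - Pminus u - x‖ ^ 2 := by
  have e : u - x = Pminus u + (u - Pminus u - x) := by abel
  have h := inner_Pminus_eq_zero u (sub_mem_H2 (sub_Pminus_mem u) hx)
  conv_lhs => rw [e]
  rw [sq, sq, sq]
  exact norm_add_sq_eq_norm_sq_add_norm_sq_of_inner_eq_zero _ _ h

theorem cauchyExt_congr_ae {a b : Torus → ℂ} (h : a =ᵐ[ell] b) : cauchyExt a = cauchyExt b := by
  ext z
  rw [cauchyExt_eq, cauchyExt_eq]
  refine integral_congr_ae ?_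
  filter_upwards [h] with t ht
  rw [ht]

theorem cauchyExt_sub_Pminus (u : L2T) {z : ℂ} (hz : ‖z‖ < 1) :
    cauchyExt (u - Pminus u : L2T) z = cauchyExt u z := by
  have h1 := hasSum_cauchyExt ((Lp.memLp (u - Pminus u)).integrable one_le_two) hz
  have h2 := hasSum_cauchyExt ((Lp.memLp u).integrable one_le_two) hz
  refine h1.unique ?_
  convert! h2 using 1
  ext n
  rw [fourierCoeff_coe_sub, fourierCoeff_Pminus, if_neg (by omega), sub_zero]

theorem concat_of_mem {α : Type*} {S : Set Torus} {h₁ h₂ : Torus → α} {t : Torus} (ht : t ∈ S) :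
    concat S h₁ h₂ t = h₁ t := if_pos ht

theorem concat_of_notMem {α : Type*} {S : Set Torus} {h₁ h₂ : Torus → α} {t : Torus}
    (ht : t ∉ S) : concat S h₁ h₂ t = h₂ t := if_neg ht

theorem eintegral_eq_coe {ν : Measure Torus} {h : Torus → ℝ} (hh : Integrable h ν) :
    eintegral ν h = ((∫ t, h t ∂ν : ℝ) : EReal) := by
  have e1 : ∫⁻ t, ENNReal.ofReal (h t) ∂ν ≠ ⊤ := hh.lintegral_lt_top.ne
  have e2 : ∫⁻ t, ENNReal.ofReal (-h t) ∂ν ≠ ⊤ := hh.neg.lintegral_lt_top.ne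
  unfold eintegral
  rw [integral_eq_lintegral_pos_part_sub_lintegral_neg_part hh, EReal.coe_sub,
    EReal.coe_ennreal_toReal e1, EReal.coe_ennreal_toReal e2]

/-! ### The criterion as an `L²` distance -/

section Criterion

variable {S : Set Torus} {f w : Torus → ℂ} {M μ : Torus → ℝ}

theorem criterion_eq (hS : NullMeasurableSet S ell) (hf : MemLp f 2 (ell.restrict S))
    (hN : Integrable (fun t => μ t * M t ^ 2) (ell.restrict Sᶜ))
    (hw1 : ∀ᵐ t ∂ell.restrict S, ‖w t‖ = 1) (hw2 : ∀ᵐ t ∂ell.restrict Sᶜ, ‖w t‖ ^ 2 = μ t)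
    (hu : MemLp (concat S (fun t => f t * w t) fun _ => 0) 2 ell) (g : L2T)
    (hG : MemLp (fun t => g t * w t) 2 ell) :
    criterion S f M μ g =
      ((‖hu.toLp - hG.toLp‖ ^ 2 - ∫ t in Sᶜ, μ t * M t ^ 2 ∂ell : ℝ) : EReal) := by
  have hfg : MemLp (fun t => f t - g t) 2 (ell.restrict S) := hf.sub ((Lp.memLp g).restrict S)
  have h2 : Integrable (fun t => ‖g t * w t‖ ^ 2) ell :=
    (memLp_two_iff_integrable_sq_norm hG.aestronglyMeasurable).mp hG
  have hd : MemLp (fun t => concat S (fun t => f t * w t) (fun _ => 0) t - g t * w t) 2 ell :=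
    hu.sub hG
  have h3 : Integrable (fun t => ‖concat S (fun t => f t * w t) (fun _ => 0) t - g t * w t‖ ^ 2)
      ell := (memLp_two_iff_integrable_sq_norm hd.aestronglyMeasurable).mp hd
  have eJ : (fun t => μ t * (‖g t‖ ^ 2 - M t ^ 2)) =ᵐ[ell.restrict Sᶜ]
      fun t => ‖g t * w t‖ ^ 2 - μ t * M t ^ 2 := by
    filter_upwards [hw2] with t ht
    rw [norm_mul, mul_pow, ht]
    ring
  have h4 : Integrable (fun t => ‖g t * w t‖ ^ 2 - μ t * M t ^ 2) (ell.restrict Sᶜ) :=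
    h2.restrict.sub hN
  have eint : eintegral (ell.restrict Sᶜ) (fun t => μ t * (‖g t‖ ^ 2 - M t ^ 2)) =
      ((∫ t in Sᶜ, ‖g t * w t‖ ^ 2 ∂ell - ∫ t in Sᶜ, μ t * M t ^ 2 ∂ell : ℝ) : EReal) := by
    rw [eintegral_eq_coe (h4.congr eJ.symm), integral_congr_ae eJ,
      integral_sub h2.restrict hN]
  have eS : ∫ t in S, ‖f t - g t‖ ^ 2 ∂ell =
      ∫ t in S, ‖concat S (fun t => f t * w t) (fun _ => 0) t - g t * w t‖ ^ 2 ∂ell := by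
    refine integral_congr_ae ?_
    filter_upwards [hw1, ae_restrict_mem₀ hS] with t ht hm
    rw [concat_of_mem hm, ← sub_mul, norm_mul, ht, mul_one]
  have eSc : ∫ t in Sᶜ, ‖g t * w t‖ ^ 2 ∂ell =
      ∫ t in Sᶜ, ‖concat S (fun t => f t * w t) (fun _ => 0) t - g t * w t‖ ^ 2 ∂ell := by
    refine integral_congr_ae ?_
    filter_upwards [ae_restrict_mem₀ hS.compl] with t hm
    rw [concat_of_notMem hm, zero_sub, norm_neg]
  have enorm : ‖hu.toLp - hG.toLp‖ ^ 2 =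
      ∫ t, ‖concat S (fun t => f t * w t) (fun _ => 0) t - g t * w t‖ ^ 2 ∂ell := by
    rw [← MemLp.toLp_sub, norm_sq_eq_integral]
    refine integral_congr_ae ?_
    filter_upwards [(hu.sub hG).coeFn_toLp] with t ht
    rw [ht, Pi.sub_apply]
  have e0 : 0 ≤ ∫ t in S, ‖f t - g t‖ ^ 2 ∂ell := integral_nonneg fun t => by positivity
  unfold criterion
  rw [eint, eLpNorm_two_eq hfg, ← ENNReal.ofReal_pow (Real.sqrt_nonneg _), Real.sq_sqrt e0,
    EReal.coe_ennreal_ofReal, max_eq_left e0, ← EReal.coe_add, enorm,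
    ← integral_add_compl₀ hS h3, ← eS, ← eSc, add_sub_assoc]

/-- On `S` one has `|gw| = |g|`, so square integrability can fail only off `S`, where `|gw|² =
μ|g|²`. The negative part of the integrand is at most `μM²`, so the extended integral is a genuine
`+∞` and not `∞ - ∞`. -/
theorem criterion_eq_top (hμ : ∀ᵐ t ∂ell.restrict Sᶜ, 0 < μ t)
    (hN : Integrable (fun t => μ t * M t ^ 2) (ell.restrict Sᶜ)) (hw : AEStronglyMeasurable w ell)
    (hw1 : ∀ᵐ t ∂ell.restrict S, ‖w t‖ = 1) (hw2 : ∀ᵐ t ∂ell.restrict Sᶜ, ‖w t‖ ^ 2 = μ t)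
    (g : L2T) (hG : ¬ MemLp (fun t => g t * w t) 2 ell) : criterion S f M μ g = ⊤ := by
  have hm : AEStronglyMeasurable (fun t => g t * w t) ell :=
    (Lp.memLp g).aestronglyMeasurable.mul hw
  have hm2 : AEStronglyMeasurable (fun t => ‖g t * w t‖ ^ 2) ell := (hm.norm.pow 2)
  rw [memLp_two_iff_integrable_sq_norm hm] at hG
  have hpos : ∫⁻ t in Sᶜ, ENNReal.ofReal (μ t * (‖g t‖ ^ 2 - M t ^ 2)) ∂ell = ⊤ := by
    by_contra hne
    apply hG
    have i1 : IntegrableOn (fun t => ‖g t * w t‖ ^ 2) S ell := by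
      have hg : Integrable (fun t => ‖g t‖ ^ 2) ell :=
        (memLp_two_iff_integrable_sq_norm (Lp.memLp g).aestronglyMeasurable).mp (Lp.memLp g)
      refine hg.restrict.congr ?_
      filter_upwards [hw1] with t ht
      rw [norm_mul, ht, mul_one]
    have i2 : IntegrableOn (fun t => ‖g t * w t‖ ^ 2) Sᶜ ell := by
      refine ⟨hm2.restrict, ?_⟩
      rw [hasFiniteIntegral_iff_ofReal (Eventually.of_forall fun t => by positivity)]
      calc ∫⁻ t in Sᶜ, ENNReal.ofReal (‖g t * w t‖ ^ 2) ∂ell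
          ≤ ∫⁻ t in Sᶜ, (ENNReal.ofReal (μ t * (‖g t‖ ^ 2 - M t ^ 2)) +
              ENNReal.ofReal (μ t * M t ^ 2)) ∂ell := by
            refine lintegral_mono_ae ?_
            filter_upwards [hw2] with t ht
            refine le_trans (ENNReal.ofReal_le_ofReal ?_) ENNReal.ofReal_add_le
            rw [norm_mul, mul_pow, ht]
            linarith
        _ = ∫⁻ t in Sᶜ, ENNReal.ofReal (μ t * (‖g t‖ ^ 2 - M t ^ 2)) ∂ell +
              ∫⁻ t in Sᶜ, ENNReal.ofReal (μ t * M t ^ 2) ∂ell :=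
            lintegral_add_right' _ hN.aestronglyMeasurable.aemeasurable.ennreal_ofReal
        _ < ⊤ := ENNReal.add_lt_top.mpr ⟨lt_top_iff_ne_top.mpr hne, hN.lintegral_lt_top⟩
    have := i1.union i2
    rwa [Set.union_compl_self, integrableOn_univ] at this
  have hneg : ∫⁻ t in Sᶜ, ENNReal.ofReal (-(μ t * (‖g t‖ ^ 2 - M t ^ 2))) ∂ell ≠ ⊤ := by
    refine ne_top_of_le_ne_top hN.lintegral_lt_top.ne (lintegral_mono_ae ?_)
    filter_upwards [hμ] with t ht
    refine ENNReal.ofReal_le_ofReal ?_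
    have : 0 ≤ μ t * ‖g t‖ ^ 2 := by positivity
    linarith
  unfold criterion eintegral
  rw [hpos, EReal.coe_ennreal_top, ← EReal.coe_ennreal_toReal hneg, EReal.top_sub_coe,
    EReal.add_top_of_ne_bot (EReal.coe_ennreal_ne_bot _)]

end Criterion

/-! ### The outer function with modulus `1 ∨ μ^{1/2}` and the Carleman-type function -/

section Outer

variable {S : Set Torus} {f : Torus → ℂ} {M μ : Torus → ℝ}

/-- The logarithm of the boundary modulus of `wSqrt`. -/
noncomputable def logModulus (S : Set Torus) (μ : Torus → ℝ) (t : Torus) : ℝ :=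
  Real.log (concat S (fun _ => 1) (fun t => √(μ t)) t)

theorem wSqrt_eq (S : Set Torus) (μ : Torus → ℝ) : wSqrt S μ = expHerglotz (logModulus S μ) := rfl

theorem integrable_logModulus (hS : NullMeasurableSet S ell) (hμ : MemL1Plus S M μ) :
    Integrable (logModulus S μ) ell := by
  have h1 : IntegrableOn (fun t => Real.log (√(μ t))) Sᶜ ell := by
    refine (hμ.integrable_log.div_const 2).congr ?_
    filter_upwards [hμ.pos] with t ht
    rw [Real.log_sqrt ht.le]
  refine (h1.integrable_indicator₀ hS.compl).congr (Eventually.of_forall fun t => ?_)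
  unfold logModulus
  by_cases ht : t ∈ S
  · rw [concat_of_mem ht, Real.log_one, Set.indicator_of_notMem (Set.notMem_compl_iff.mpr ht)]
  · rw [concat_of_notMem ht, Set.indicator_of_mem ht]

theorem exp_logModulus_of_mem {t : Torus} (ht : t ∈ S) : Real.exp (logModulus S μ t) = 1 := by
  unfold logModulus
  rw [concat_of_mem ht, Real.log_one, Real.exp_zero]

theorem exp_logModulus_of_notMem {t : Torus} (ht : t ∉ S) (hμ : 0 < μ t) :
    Real.exp (logModulus S μ t) = √(μ t) := by
  unfold logModulus
  rw [concat_of_notMem ht, Real.exp_log (Real.sqrt_pos.mpr hμ)]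

theorem memLp_concat_zero (hS : NullMeasurableSet S ell) {a : Torus → ℂ}
    (ha : MemLp a 2 (ell.restrict S)) : MemLp (concat S a fun _ => 0) 2 ell := by
  have e := hS.toMeasurable_ae_eq
  rw [← Measure.restrict_congr_set e,
    ← memLp_indicator_iff_restrict (measurableSet_toMeasurable _ _)] at ha
  refine (memLp_congr_ae ?_).mp ha
  refine (indicator_ae_eq_of_ae_eq_set e).trans (Eventually.of_forall fun t => ?_)
  by_cases ht : t ∈ S
  · rw [concat_of_mem ht, Set.indicator_of_mem ht]
  · rw [concat_of_notMem ht, Set.indicator_of_notMem ht]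

theorem carleman_eq (hS : NullMeasurableSet S ell) (z : ℂ) :
    carleman S f μ z =
      cauchyExt (concat S (fun t => f t * bdry (wSqrt S μ) t) fun _ => 0) z / wSqrt S μ z := by
  have h : (1 : ℂ) / (2 * Complex.I * Real.pi * wSqrt S μ z) =
      1 / wSqrt S μ z * (1 / (2 * Complex.I * Real.pi)) := by
    rw [one_div_mul_one_div, mul_comm (wSqrt S μ z)]
  unfold carleman
  rw [h, mul_assoc, lineIntegral_div, cauchyExt_eq, ← integral_indicator₀ hS, mul_comm (1 / wSqrt S μ z),
    ← div_eq_mul_one_div]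
  refine congrArg (· / wSqrt S μ z) (integral_congr_ae (Eventually.of_forall fun t => ?_))
  dsimp only
  by_cases ht : t ∈ S
  · rw [concat_of_mem ht, Set.indicator_of_mem ht]
    ring
  · rw [concat_of_notMem ht, Set.indicator_of_notMem ht, zero_mul]

end Outer

/-! ### Multiplication of `H²` by an unbounded outer function -/

/-- Meant for `w = bdry F`, a limit chosen point by point, whose measurability is not immediate; it
is inherited from the quotient `l / k`. -/
theorem aestronglyMeasurable_of_mul {k l w : Torus → ℂ} (hk : AEStronglyMeasurable k ell)
    (hl : AEStronglyMeasurable l ell) (h0 : ∀ᵐ t ∂ell, k t ≠ 0)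
    (h : ∀ᵐ t ∂ell, k t * w t = l t) : AEStronglyMeasurable w ell := by
  refine (hl.aemeasurable.div hk.aemeasurable).aestronglyMeasurable.congr ?_
  filter_upwards [h0, h] with t h1 h2
  rw [Pi.div_apply, ← h2, mul_div_cancel_left₀ _ h1]

/-- If `g ∈ H²` and the product of `g` with an outer function is square integrable, then this
product belongs to `H²`. -/
theorem IsHardy.mul_outer {φ : Torus → ℝ} (hφ : Integrable φ ell) {g : Torus → ℂ}
    (hg : IsHardy g) (hG : MemLp (fun t => g t * bdry (expHerglotz φ) t) 2 ell) :
    IsHardy fun t => g t * bdry (expHerglotz φ) t := by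
  obtain ⟨k, l, hk, hl, -, -, hl1, hkl, -⟩ := exists_boundary_quotient hφ
  -- With `w = l / k`, the product `k (gw) = gl` lies in `H²` since `l` is bounded; the outer factor
  -- `k` can then be cancelled.
  refine isHardy_of_outer_mul (hφ.sup (integrable_const 0)) hk hG ?_
  refine (hg.mul_bdd hl.isHardy hl1).congr ?_
  filter_upwards [hkl] with t ht
  rw [← ht]
  ring

/-- The square integrable products of an outer function with members of `H²` are dense in `H²`. -/
theorem exists_tendsto_mul_outer {φ : Torus → ℝ} (hφ : Integrable φ ell) {v : Torus → ℂ}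
    (hv : IsHardy v) : ∃ g : ℕ → Torus → ℂ, (∀ j, IsHardy (g j)) ∧
      (∀ j, MemLp (fun t => g j t * bdry (expHerglotz φ) t) 2 ell) ∧
      Tendsto (fun j => ∫ t, ‖v t - g j t * bdry (expHerglotz φ) t‖ ^ 2 ∂ell) atTop (𝓝 0) := by
  obtain ⟨k, l, hk, hl, hk0, hk1, hl1, hkl, -⟩ := exists_boundary_quotient hφ
  obtain ⟨q, hq, hle, hlim⟩ := exists_approx_inverse (hφ.neg.sup (integrable_const 0)) hl
  have hw := aestronglyMeasurable_of_mul hk.isHardy.memLp.aestronglyMeasurable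
    hl.isHardy.memLp.aestronglyMeasurable hk0 hkl
  -- The formal solution of `gw = v` is `v k / l`. Replacing `1 / l` by `q j` gives `g j = v q j k`,
  -- for which `g j w = (l q j) v → v` with domination by `|v|`.
  have hg : ∀ j, IsHardy fun t => v t * q j t * k t := fun j =>
    (hv.mul_bdd (hq j).1 (hq j).2.choose_spec).mul_bdd hk.isHardy hk1
  have hgw : ∀ j, ∀ᵐ t ∂ell,
      v t * q j t * k t * bdry (expHerglotz φ) t = l t * q j t * v t := fun j => by
    filter_upwards [hkl] with t ht
    rw [← ht]
    ring
  have hm : ∀ j, AEStronglyMeasurable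
      (fun t => v t * q j t * k t * bdry (expHerglotz φ) t) ell := fun j =>
    (hg j).memLp.aestronglyMeasurable.mul hw
  refine ⟨_, hg, fun j => ?_, ?_⟩
  · refine hv.memLp.of_le (hm j) ?_
    filter_upwards [hgw j, hle j] with t h1 h2
    rw [h1, norm_mul]
    exact mul_le_of_le_one_left (norm_nonneg _) h2
  · have hv2 : Integrable (fun t => ‖v t‖ ^ 2) ell :=
      (memLp_two_iff_integrable_sq_norm hv.memLp.aestronglyMeasurable).mp hv.memLp
    have hm2 : ∀ j, AEStronglyMeasurable
        (fun t => ‖v t - v t * q j t * k t * bdry (expHerglotz φ) t‖ ^ 2) ell := fun j =>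
      (continuous_pow 2).comp_aestronglyMeasurable
        (hv.memLp.aestronglyMeasurable.sub (hm j)).norm
    have h := tendsto_integral_of_dominated_convergence (μ := ell)
      (F := fun j t => ‖v t - v t * q j t * k t * bdry (expHerglotz φ) t‖ ^ 2) (f := fun _ => 0)
      (fun t => 4 * ‖v t‖ ^ 2) hm2 (hv2.const_mul 4)
      (fun j => ?_) ?_
    · simpa using h
    · filter_upwards [hgw j, hle j] with t h1 h2
      have h3 : ‖v t - l t * q j t * v t‖ ≤ 2 * ‖v t‖ := by
        refine (norm_sub_le _ _).trans ?_
        have : ‖l t * q j t * v t‖ ≤ ‖v t‖ := by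
          rw [norm_mul]; exact mul_le_of_le_one_left (norm_nonneg _) h2
        linarith
      rw [h1, norm_pow, norm_norm]
      calc ‖v t - l t * q j t * v t‖ ^ 2 ≤ (2 * ‖v t‖) ^ 2 := by gcongr
        _ = 4 * ‖v t‖ ^ 2 := by ring
    · filter_upwards [ae_all_iff.mpr hgw, hlim] with t h1 h2
      simp_rw [h1]
      have h3 := ((h2.mul_const (v t)).const_sub (v t)).norm.pow 2
      simpa using h3

/-- If `G w = V` in the disk, with `w` outer and `G`, `V` in `H²`, then `g w = v` a.e. -/
theorem ae_mul_outer_eq {φ : Torus → ℝ} (hφ : Integrable φ ell) {g v : Torus → ℂ}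
    (hg : IsHardy g) (hv : IsHardy v)
    (h : ∀ z : ℂ, ‖z‖ < 1 → cauchyExt g z = cauchyExt v z / expHerglotz φ z) :
    ∀ᵐ t ∂ell, g t * bdry (expHerglotz φ) t = v t := by
  obtain ⟨k, l, hk, hl, hk0, hk1, hl1, hkl, -⟩ := exists_boundary_quotient hφ
  have h1 : Integrable (fun t => -max (φ t) 0) ell := (hφ.sup (integrable_const 0)).neg
  -- Clearing the denominator of `w = l / k` turns the identity into `gl = vk`, between two members
  -- of `H²`, which their values in the disk determine.
  have key : (fun t => g t * l t) =ᵐ[ell] fun t => v t * k t := by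
    refine (hg.mul_bdd hl.isHardy hl1).ae_eq_of_cauchyExt_eq (hv.mul_bdd hk.isHardy hk1)
      fun z hz => ?_
    rw [cauchyExt_mul hg hl.isHardy hz, cauchyExt_mul hv hk.isHardy hz, hl.cauchyExt_eq z hz,
      hk.cauchyExt_eq z hz, h z hz]
    have e : expHerglotz (fun t => -max (-φ t) 0) z =
        expHerglotz φ z * expHerglotz (fun t => -max (φ t) 0) z := by
      rw [← expHerglotz_add hφ h1 hz]
      congr 2
      ext t
      rcases le_total (φ t) 0 with h | h
      · rw [max_eq_right h, max_eq_left (by linarith)]; ring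
      · rw [max_eq_left h, max_eq_right (by linarith)]; ring
    have hne : expHerglotz φ z ≠ 0 := Complex.exp_ne_zero _
    rw [e]
    field_simp
  filter_upwards [key, hkl, hk0] with t h1 h2 h0
  rw [← h2] at h1
  apply mul_left_cancel₀ h0
  linear_combination h1

end HardyDual

/-! ### The dual functional and its minimizer -/

theorem mainTheorem10
    (S : Set HardyDual.Torus)
    (hS : NullMeasurableSet S HardyDual.ell)
    (hS_pos : 0 < HardyDual.ell S)
    (hJ_pos : 0 < HardyDual.ell Sᶜ)
    (hS_bdry : HardyDual.ell (frontier S) = 0)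
    (M : HardyDual.Torus → ℝ)
    (hM : MemLp M 2 (HardyDual.ell.restrict Sᶜ))
    (hM_pos : ∀ᵐ t ∂HardyDual.ell.restrict Sᶜ, 0 < M t)
    (hM_log : Integrable (fun t => Real.log (M t)) (HardyDual.ell.restrict Sᶜ))
    (f : HardyDual.Torus → ℂ)
    (hf : MemLp f 2 (HardyDual.ell.restrict S))
    (hf_not : ¬ ∃ g ∈ HardyDual.H2,
      (∀ᵐ t ∂HardyDual.ell.restrict S, f t = g t) ∧
      ∀ᵐ t ∂HardyDual.ell.restrict Sᶜ, ‖g t‖ ≤ M t)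
    (μ : HardyDual.Torus → ℝ)
    (hμ : HardyDual.MemL1Plus S M μ) :
    (∃ hu : MemLp
        (HardyDual.concat S (fun t => f t * HardyDual.bdry (HardyDual.wSqrt S μ) t) (fun _ => 0))
        2 HardyDual.ell,
      HardyDual.dualFunctional S f M μ =
        ((‖HardyDual.Pminus hu.toLp‖ ^ 2 -
          (eLpNorm (fun t => Real.sqrt (μ t) * M t) 2
            (HardyDual.ell.restrict Sᶜ)).toReal ^ 2 : ℝ) : EReal)) ∧
    (∀ g : HardyDual.L2T, HardyDual.IsH2With (HardyDual.carleman S f μ) g →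
      IsMinOn (HardyDual.criterion S f M μ) HardyDual.H2 g ∧
      HardyDual.criterion S f M μ g = HardyDual.dualFunctional S f M μ) ∧
    (MemLp (fun t => (μ t)⁻¹) ⊤ (HardyDual.ell.restrict Sᶜ) →
      ∃ g : HardyDual.L2T, HardyDual.IsH2With (HardyDual.carleman S f μ) g) := by
  open HardyDual Filter Topology in
  have hφ := integrable_logModulus hS hμ
  obtain ⟨k, l, hk, hl, hk0, -, -, hkl, hwn⟩ := exists_boundary_quotient hφ
  have hw := aestronglyMeasurable_of_mul hk.isHardy.memLp.aestronglyMeasurable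
    hl.isHardy.memLp.aestronglyMeasurable hk0 hkl
  rw [← wSqrt_eq] at hkl hwn hw
  have hw1 : ∀ᵐ t ∂ell.restrict S, ‖bdry (wSqrt S μ) t‖ = 1 := by
    filter_upwards [ae_restrict_of_ae hwn, ae_restrict_mem₀ hS] with t h1 h2
    rw [h1, exp_logModulus_of_mem h2]
  have hw2 : ∀ᵐ t ∂ell.restrict Sᶜ, ‖bdry (wSqrt S μ) t‖ ^ 2 = μ t := by
    filter_upwards [ae_restrict_of_ae hwn, ae_restrict_mem₀ hS.compl, hμ.pos] with t h1 h2 h3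
    rw [h1, exp_logModulus_of_notMem h2 h3, Real.sq_sqrt h3.le]
  have hfw : MemLp (fun t => f t * bdry (wSqrt S μ) t) 2 (ell.restrict S) := by
    refine hf.of_le (hf.aestronglyMeasurable.mul hw.restrict) ?_
    filter_upwards [hw1] with t ht
    rw [norm_mul, ht, mul_one]
  have hu := memLp_concat_zero hS hfw
  have hN : (eLpNorm (fun t => √(μ t) * M t) 2 (ell.restrict Sᶜ)).toReal ^ 2 =
      ∫ t in Sᶜ, μ t * M t ^ 2 ∂ell := by
    have e : ∀ᵐ t ∂ell.restrict Sᶜ, ‖√(μ t) * M t‖ ^ 2 = μ t * M t ^ 2 := by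
      filter_upwards [hμ.pos] with t ht
      rw [Real.norm_eq_abs, sq_abs, mul_pow, Real.sq_sqrt ht.le]
    have hm : MemLp (fun t => √(μ t) * M t) 2 (ell.restrict Sᶜ) := by
      rw [memLp_two_iff_integrable_sq_norm]
      · exact hμ.integrable.congr (EventuallyEq.symm e)
      · refine AEStronglyMeasurable.congr (f := fun t => √(μ t * M t ^ 2))
          (Real.continuous_sqrt.comp_aestronglyMeasurable hμ.integrable.aestronglyMeasurable) ?_
        filter_upwards [hμ.pos, hM_pos] with t h1 h2
        rw [Real.sqrt_mul h1.le, Real.sqrt_sq h2.le]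
    rw [eLpNorm_two_eq hm, ENNReal.toReal_ofReal (Real.sqrt_nonneg _),
      Real.sq_sqrt (integral_nonneg fun t => by positivity), integral_congr_ae e]
  set U : L2T := hu.toLp with hU
  set N : ℝ := ∫ t in Sᶜ, μ t * M t ^ 2 ∂ell
  have hcrit : ∀ g ∈ H2, ∀ hG : MemLp (fun t => g t * bdry (wSqrt S μ) t) 2 ell,
      criterion S f M μ g =
        ((‖Pminus U‖ ^ 2 + ‖U - Pminus U - hG.toLp‖ ^ 2 - N : ℝ) : EReal) := by
    intro g hg hG
    have hx : hG.toLp ∈ H2 := ((isHardy_coe hg).mul_outer hφ hG).toLp_mem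
    rw [criterion_eq hS hf hμ.integrable hw1 hw2 hu g hG, ← hU, norm_sub_sq_eq U hx]
  have hPhi : dualFunctional S f M μ = ((‖Pminus U‖ ^ 2 - N : ℝ) : EReal) := by
    refine le_antisymm ?_ ?_
    -- Density is applied to `P₊u = U - Pminus U`: admissible `g j` make the second term of `hcrit`
    -- tend to `0`.
    · obtain ⟨g, hg, hG, hlim⟩ := exists_tendsto_mul_outer hφ (isHardy_coe (sub_Pminus_mem U))
      have hge : ∀ j, (fun t => ((hg j).memLp.toLp : L2T) t * bdry (wSqrt S μ) t) =ᵐ[ell]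
          fun t => g j t * bdry (wSqrt S μ) t := fun j => by
        filter_upwards [(hg j).memLp.coeFn_toLp] with t ht
        rw [ht]
      have hG' : ∀ j, MemLp (fun t => ((hg j).memLp.toLp : L2T) t * bdry (wSqrt S μ) t) 2 ell :=
        fun j => (memLp_congr_ae (hge j)).mpr (hG j)
      have hle : ∀ j, dualFunctional S f M μ ≤ ((‖Pminus U‖ ^ 2 +
          ∫ t, ‖(U - Pminus U : L2T) t - g j t * bdry (wSqrt S μ) t‖ ^ 2 ∂ell - N : ℝ) :
            EReal) := by
        intro j
        refine (iInf₂_le _ (hg j).toLp_mem).trans_eq ?_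
        rw [hcrit _ (hg j).toLp_mem (hG' j), norm_sq_eq_integral (U - Pminus U - (hG' j).toLp)]
        congr 3
        refine integral_congr_ae ?_
        filter_upwards [Lp.coeFn_sub (U - Pminus U) (hG' j).toLp, (hG' j).coeFn_toLp, hge j]
          with t h1 h2 h3
        rw [h1, Pi.sub_apply, h2, h3]
      have hlim' := (hlim.const_add (‖Pminus U‖ ^ 2)).sub_const N
      rw [add_zero] at hlim'
      exact ge_of_tendsto' (x := atTop) ((continuous_coe_real_ereal.tendsto _).comp hlim') hle
    · refine le_iInf₂ fun g hg => ?_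
      by_cases hG : MemLp (fun t => g t * bdry (wSqrt S μ) t) 2 ell
      · rw [hcrit g hg hG, EReal.coe_le_coe_iff]
        linarith [sq_nonneg ‖U - Pminus U - hG.toLp‖]
      · rw [criterion_eq_top hμ.pos hμ.integrable hw hw1 hw2 g hG]
        exact le_top
  -- The Cauchy integral ignores `Pminus U`, so the numerator of the Carleman-type function is the
  -- extension of `P₊u`.
  have hcar : ∀ z : ℂ, ‖z‖ < 1 → carleman S f μ z =
      cauchyExt (U - Pminus U : L2T) z / expHerglotz (logModulus S μ) z := fun z hz => by
    rw [carleman_eq hS, cauchyExt_sub_Pminus U hz, cauchyExt_congr_ae hu.coeFn_toLp]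
    rfl
  refine ⟨⟨hu, ?_⟩, fun g hg => ?_, fun hinv => ?_⟩
  · rw [hN]; exact hPhi
  · have hgv := ae_mul_outer_eq hφ (isHardy_coe hg.1) (isHardy_coe (sub_Pminus_mem U))
      fun z hz => by rw [← hg.2 z (mem_ball_zero_iff.mpr hz), hcar z hz]
    have hG : MemLp (fun t => g t * bdry (wSqrt S μ) t) 2 ell :=
      (memLp_congr_ae hgv).mpr (Lp.memLp (U - Pminus U))
    have hz : U - Pminus U - hG.toLp = 0 := by
      rw [sub_eq_zero]
      refine Lp.ext ?_
      filter_upwards [hG.coeFn_toLp, hgv] with t h1 h2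
      rw [h1]
      exact h2.symm
    have hval : criterion S f M μ g = dualFunctional S f M μ := by
      rw [hcrit g hg.1 hG, hPhi, hz]
      simp
    exact ⟨fun x hx => hval.trans_le (iInf₂_le x hx), hval⟩
  · obtain ⟨C, hC⟩ : ∃ C : ℝ, ∀ᵐ t ∂ell.restrict Sᶜ, ‖(μ t)⁻¹‖ ≤ C :=
      ⟨_, ae_le_lpNorm_exponent_top hinv⟩
    -- The bound on `log |1/w|` is `0` on `S`, where `|w| = 1`, and `(log C)/2` off `S`, where
    -- `|1/w| = μ^{-1/2}`.
    have hle : ∀ᵐ t ∂ell, -logModulus S μ t ≤ max 0 (Real.log C / 2) := by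
      refine ae_of_ae_restrict_of_ae_restrict_compl S ?_ ?_
      · filter_upwards [ae_restrict_mem₀ hS] with t ht
        rw [logModulus, concat_of_mem ht, Real.log_one, neg_zero]
        exact le_max_left _ _
      · filter_upwards [ae_restrict_mem₀ hS.compl, hμ.pos, hC] with t ht h0 hc
        refine le_trans ?_ (le_max_right _ _)
        rw [logModulus, concat_of_notMem ht, Real.log_sqrt h0.le, ← neg_div, ← Real.log_inv]
        rw [Real.norm_of_nonneg (inv_nonneg.mpr h0.le)] at hc
        have := Real.log_le_log (inv_pos.mpr h0) hc
        linarith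
    have hneg : Integrable (fun t => -logModulus S μ t) ell := hφ.neg
    -- `r` is the boundary function of the bounded outer function `1/w`, so `g = (P₊u) r` belongs to
    -- `H²`.
    obtain ⟨r, hr⟩ := exists_isBoundary_expHerglotz hneg hle
    have hg := (isHardy_coe (sub_Pminus_mem U)).mul_bdd hr.isHardy (hr.norm_le_exp hneg hle)
    refine ⟨hg.memLp.toLp, hg.toLp_mem, fun z hz => ?_⟩
    rw [mem_ball_zero_iff] at hz
    rw [cauchyExt_congr_ae hg.memLp.coeFn_toLp,
      cauchyExt_mul (isHardy_coe (sub_Pminus_mem U)) hr.isHardy hz, hr.cauchyExt_eq z hz,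
      hcar z hz, div_eq_mul_inv]
    congr 1
    refine inv_eq_of_mul_eq_one_right ?_
    rw [← expHerglotz_add hφ hneg hz]
    simp [expHerglotz, herglotz]
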